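/- Let $\Phi$ be an irreducible reduced crystallographic finite root system of rank $n\ge 1$ in a real vector space $V$, with simple roots $\Pi=\{\alpha_i : i\in I\}$, Cartan matrix $a_{ij}=\langle\alpha_i^\vee,\alpha_j\rangle$ and positive roots $\Phi_{>0}$. Let $h$ be its Coxeter number (the order of any Coxeter element, i.e. of any product of all simple reflections, each taken once, in some order), and let $w_\circ$ be the longest element of its Weyl group. Put $\Phi_{\ge -1}=\Phi_{>0}\cup(-\Pi)$. The Coxeter graph on $I$, in which $i\ne j$ are joined iff $a_{ij}a_{ji}>0$, is bipartite; let $I=I_+\sqcup I_-$ be its two parts (for $n=1$ one of them is empty). For $x\in V$ let $[x:\alpha_i]$ denote the coefficient of $\alpha_i$ in the expansion of $x$ in the basis $\Pi$. For a sign $\varepsilon\in\{+,-\}$ define $\tau_\varepsilon:V\to V$ by $$[\tau_\varepsilon x:\alpha_i]=\begin{cases}-[x:\alpha_i]-\sum_{j\ne i}a_{ij}\max([x:\alpha_j],0) & \text{if } i\in I_\varepsilon,\\ [x:\alpha_i] & \text{otherwise.}\end{cases}$$ The maps $\tau_\pm$ are involutive (that is, $\tau_\pm^2=\mathrm{id}$)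 and preserve $\Phi_{\ge -1}$. Let $D$ be the group of permutations of $\Phi_{\ge -1}$ generated by $\tau_-$ and $\tau_+$. 1. Every $D$-orbit in $\Phi_{\ge -1}$ has a nonempty intersection with $-\Pi$. Moreover, $\Omega\mapsto\Omega\cap(-\Pi)$ is a bijection between the $D$-orbits in $\Phi_{\ge -1}$ and the $\langle -w_\circ\rangle$-orbits in $-\Pi$. 2. The order of $\tau_-\tau_+$ in $D$ equals $(h+2)/2$ if $w_\circ=-1$, and equals $h+2$ otherwise. Accordingly, if $n\ge 2$, then $D$ is the dihedral group of order $h+2$ if $w_\circ=-1$, and the dihedral group of order $2(h+2)$ otherwise. -/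

import Mathlib

noncomputable section

namespace FZ

open Finset Module

variable {ι M N : Type*} [AddCommGroup M] [Module ℝ M] [AddCommGroup N] [Module ℝ N]
  {P : RootPairing ι ℝ M N}

/-- The entry `a i j = ⟨αᵢ^∨, αⱼ⟩` of the Cartan matrix. (With Mathlib's convention
`P.pairing j i = ⟨root j, coroot i⟩`, so this is the transpose of `RootPairing.Base.cartanMatrix`.) -/
def cartan (b : P.Base) (i j : b.support) : ℝ := P.pairing j i

/-- The Coxeter graph: vertices are the indices of the simple roots, and `i ≠ j` are joined by an
edge whenever `a i j * a j i > 0`. -/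
def coxeterGraph (b : P.Base) : SimpleGraph b.support where
  Adj i j := i ≠ j ∧ 0 < cartan b i j * cartan b j i
  symm := ⟨fun i j h => ⟨h.1.symm, by rw [mul_comm]; exact h.2⟩⟩
  loopless := ⟨fun _ h => h.1 rfl⟩

/-- The coefficient `[x : αᵢ]` of `αᵢ` in the expansion of `x` in the basis of simple roots. -/
def coeff [P.IsRootSystem] (b : P.Base) (x : M) (i : b.support) : ℝ := b.toWeightBasis.repr x i

/-- The set `-Π` of negative simple roots. -/
def negSimple (b : P.Base) : Set M := {x | ∃ i ∈ b.support, x = -P.root i}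

/-- The set `Φ_{≥ -1}`: the positive roots together with the negative simple roots. -/
def almostPos (b : P.Base) : Set M := {x | ∃ k, b.IsPos k ∧ x = P.root k} ∪ negSimple b

open Classical in
/-- The piecewise-linear map `τ_s` of the ambient space, for a sign `s = ±1`; here `ε` is the
sign function of the bipartition `I = I₊ ∪ I₋`. -/
def tau [P.IsRootSystem] (b : P.Base) (ε : b.support → ℤˣ) (s : ℤˣ) (x : M) : M :=
  b.toWeightBasis.equivFun.symm fun i =>
    if ε i = s then -coeff b x i - ∑ j ∈ univ.erase i, cartan b i j * max (coeff b x j) 0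
    else coeff b x i

section Aux

/-! Auxiliary facts: `τ_s` is an involution and preserves `Φ_{≥ -1}`. -/

open Classical in
/-- The variant of `τ_s` where the coefficients with index in `S` are modified. -/
def tauOn [P.IsRootSystem] (b : P.Base) (S : Finset b.support) (x : M) : M :=
  b.toWeightBasis.equivFun.symm fun i =>
    if i ∈ S then -coeff b x i - ∑ j ∈ univ.erase i, cartan b i j * max (coeff b x j) 0
    else coeff b x i

open Classical in
lemma tau_eq [P.IsRootSystem] (b : P.Base) (ε : b.support → ℤˣ) (s : ℤˣ) (x : M) :
    tau b ε s x = tauOn b (univ.filter fun i => ε i = s) x := by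
  simp [tau, tauOn]

lemma coeff_ext [P.IsRootSystem] (b : P.Base) {x y : M} (h : ∀ i, coeff b x i = coeff b y i) :
    x = y :=
  b.toWeightBasis.ext_elem h

open Classical in
lemma coeff_tauOn [P.IsRootSystem] (b : P.Base) (S : Finset b.support) (x : M) (i : b.support) :
    coeff b (tauOn b S x) i =
      if i ∈ S then -coeff b x i - ∑ j ∈ univ.erase i, cartan b i j * max (coeff b x j) 0
      else coeff b x i := by
  have := congrFun (b.toWeightBasis.equivFun.apply_symm_apply fun i =>
    if i ∈ S then -coeff b x i - ∑ j ∈ univ.erase i, cartan b i j * max (coeff b x j) 0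
    else coeff b x i) i
  rw [Basis.equivFun_apply] at this
  exact this

/-- Distinct indices with the same colour have vanishing Cartan matrix entry. -/
lemma cartan_eq_zero [P.IsCrystallographic] [Finite ι] (b : P.Base)
    (ε : (coxeterGraph b).Coloring ℤˣ) {i j : b.support} (hij : i ≠ j) (h : ε i = ε j) :
    cartan b i j = 0 := by
  have hna : ¬ (coxeterGraph b).Adj i j := fun hadj => ε.valid hadj h
  by_contra hne
  have hne' : cartan b j i ≠ 0 := fun h0 => hne (P.pairing_eq_zero_iff.mp h0)
  have hle : ∀ {k l : b.support}, k ≠ l → cartan b k l ≤ 0 := by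
    intro k l hkl
    have h1 := b.pairingIn_le_zero_of_ne
      (fun h => hkl (Subtype.ext h.symm)) l.2 k.2
    have h2 : cartan b k l = ((P.pairingIn ℤ l k : ℤ) : ℝ) := by
      simp [cartan, ← P.algebraMap_pairingIn ℤ]
    rw [h2]; exact_mod_cast h1
  exact hna ⟨hij, mul_pos_of_neg_of_neg (lt_of_le_of_ne (hle hij) hne)
    (lt_of_le_of_ne (hle hij.symm) hne')⟩

lemma tau_tau [P.IsRootSystem] [P.IsCrystallographic] [Finite ι] (b : P.Base)
    (ε : (coxeterGraph b).Coloring ℤˣ) (s : ℤˣ) (x : M) : tau b ε s (tau b ε s x) = x := by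
  classical
  refine coeff_ext b fun i => ?_
  simp only [tau_eq, coeff_tauOn, mem_filter, mem_univ, true_and]
  by_cases hi : ε i = s
  · rw [if_pos hi, if_pos hi]
    have : ∑ j ∈ univ.erase i, cartan b i j * max (if ε j = s then
          -coeff b x j - ∑ k ∈ univ.erase j, cartan b j k * max (coeff b x k) 0
          else coeff b x j) 0 =
        ∑ j ∈ univ.erase i, cartan b i j * max (coeff b x j) 0 := by
      refine sum_congr rfl fun j hj => ?_
      split_ifs with hjs
      · rw [cartan_eq_zero b ε (Finset.ne_of_mem_erase hj).symm (hi.trans hjs.symm)]; simp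
      · rfl
    rw [this]; ring
  · rw [if_neg hi, if_neg hi]

lemma coeff_root_nonneg [P.IsRootSystem] (b : P.Base) {k : ι} (hk : b.IsPos k) (i : b.support) :
    0 ≤ coeff b (P.root k) i := by
  classical
  obtain ⟨f, hf, hf' | hf'⟩ := b.exists_root_eq_sum_nat_or_neg k
  · rw [hf', coeff, ← b.support.sum_coe_sort, map_sum, Finsupp.finsetSum_apply]
    refine sum_nonneg fun j _ => ?_
    rw [map_nsmul, b.toWeightBasis_repr_root]
    simp only [Finsupp.smul_apply, nsmul_eq_mul, Finsupp.single_apply]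
    split_ifs <;> simp
  · exfalso
    have h1 : P.root k = ∑ j ∈ b.support, (-(f j : ℤ)) • P.root j := by
      rw [hf']; simp
    have h2 := b.height_eq_sum h1
    rw [RootPairing.Base.isPos_iff, h2] at hk
    have : 0 ≤ ∑ j ∈ b.support, (f j : ℤ) := sum_nonneg fun _ _ => by positivity
    rw [sum_neg_distrib] at hk
    omega

open Classical in
lemma coeff_negSimple [P.IsRootSystem] (b : P.Base) (i j : b.support) :
    coeff b (-P.root j) i = if j = i then -1 else 0 := by
  rw [coeff, map_neg, b.toWeightBasis_repr_root, Finsupp.neg_apply, Finsupp.single_apply]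
  split_ifs <;> simp

lemma coeff_reflection [P.IsRootSystem] (b : P.Base) (i j : b.support) (x : M) :
    coeff b (P.reflection i x) j = coeff b x j -
      (∑ k, cartan b i k * coeff b x k) * coeff b (P.root i) j := by
  have hx : P.coroot' i x = ∑ k, cartan b i k * coeff b x k := by
    conv_lhs => rw [← b.toWeightBasis.sum_repr x]
    rw [map_sum]
    refine sum_congr rfl fun k _ => ?_
    simp [cartan, coeff, mul_comm]
  rw [P.reflection_apply, ← hx, coeff, map_sub, map_smul, Finsupp.sub_apply, Finsupp.smul_apply,
    smul_eq_mul]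
  rfl

lemma tauOn_singleton_mem [P.IsRootSystem] [P.IsCrystallographic] [P.IsReduced] [Finite ι]
    (b : P.Base) (i : b.support) {x : M} (hx : x ∈ almostPos b) :
    tauOn b {i} x ∈ almostPos b := by
  classical
  rcases hx with ⟨k, hk, rfl⟩ | ⟨j, hj, rfl⟩
  · have h1 : tauOn b {i} (P.root k) = P.reflection i (P.root k) := by
      refine coeff_ext b fun j => ?_
      rw [coeff_tauOn, coeff_reflection]
      have h2 : coeff b (P.root i) j = if i = j then 1 else 0 := by
        rw [coeff, b.toWeightBasis_repr_root, Finsupp.single_apply]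
      by_cases hij : j = i
      · subst hij
        rw [if_pos (mem_singleton_self _), h2, if_pos rfl,
          ← add_sum_erase univ _ (mem_univ j)]
        have h3 : ∑ l ∈ univ.erase j, cartan b j l * max (coeff b (P.root k) l) 0 =
            ∑ l ∈ univ.erase j, cartan b j l * coeff b (P.root k) l :=
          sum_congr rfl fun l _ => by rw [max_eq_left (coeff_root_nonneg b hk l)]
        have h4 : cartan b j j = 2 := by simp [cartan]
        rw [h3, h4]; ring
      · rw [if_neg (by simpa using hij), h2, if_neg (fun h => hij h.symm)]; ring
    rw [h1]
    by_cases hki : k = i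
    · subst hki
      exact Or.inr ⟨i, i.2, by simp⟩
    · exact Or.inl ⟨P.reflectionPerm i k,
        RootPairing.Base.IsPos.reflectionPerm hk i.2 hki, by simp⟩
  · lift j to b.support using hj
    have hmax : ∀ l, max (coeff b (-P.root j) l) 0 = 0 := by
      intro l
      rw [coeff_negSimple]
      split_ifs <;> simp
    by_cases hij : j = i
    · subst hij
      refine Or.inl ⟨j, b.isPos_of_mem_support j.2, coeff_ext b fun l => ?_⟩
      rw [coeff_tauOn]
      have h2 : coeff b (P.root j) l = if j = l then 1 else 0 := by
        rw [coeff, b.toWeightBasis_repr_root, Finsupp.single_apply]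
      simp only [hmax, h2, mul_zero, sum_const_zero, mem_singleton]
      by_cases h : j = l
      · subst h; simp [coeff_negSimple]
      · simp [coeff_negSimple, h]
    · refine Or.inr ⟨j, j.2, coeff_ext b fun l => ?_⟩
      rw [coeff_tauOn]
      simp only [hmax, mul_zero, sum_const_zero, mem_singleton]
      by_cases h : l = i
      · subst h
        rw [coeff_negSimple]; simp [hij]
      · simp [h]

lemma tau_mem [P.IsRootSystem] [P.IsCrystallographic] [P.IsReduced] [Finite ι]
    (b : P.Base) (ε : (coxeterGraph b).Coloring ℤˣ) (s : ℤˣ) {x : M} (hx : x ∈ almostPos b) :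
    tau b ε s x ∈ almostPos b := by
  classical
  rw [tau_eq]
  have key : ∀ S : Finset b.support, (∀ i ∈ S, ε i = s) → tauOn b S x ∈ almostPos b := by
    intro S
    induction S using Finset.induction_on with
    | empty =>
      intro _
      have : tauOn b ∅ x = x := coeff_ext b fun i => by simp [coeff_tauOn]
      rwa [this]
    | insert a S ha ih =>
      intro hS
      have h1 : tauOn b (insert a S) x = tauOn b {a} (tauOn b S x) := by
        refine coeff_ext b fun i => ?_
        rw [coeff_tauOn, coeff_tauOn]
        by_cases hia : i = a
        · subst hia
          rw [if_pos (mem_insert_self _ _), if_pos (mem_singleton_self _), coeff_tauOn, if_neg ha]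
          congr 1
          refine sum_congr rfl fun j hj => ?_
          rw [coeff_tauOn]
          split_ifs with hjS
          · rw [cartan_eq_zero b ε (Finset.ne_of_mem_erase hj).symm
              ((hS i (mem_insert_self _ _)).trans (hS j (mem_insert_of_mem hjS)).symm)]
            simp
          · rfl
        · simp [coeff_tauOn, hia]
      rw [h1]
      exact tauOn_singleton_mem b a (ih fun i hi => hS i (mem_insert_of_mem hi))
  exact key _ fun i hi => (mem_filter.mp hi).2

end Aux

/-- The involution `τ_s` as a permutation of `Φ_{≥ -1}`. -/
def tauPerm [P.IsRootSystem] [P.IsCrystallographic] [P.IsReduced] [Finite ι]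
    (b : P.Base) (ε : (coxeterGraph b).Coloring ℤˣ) (s : ℤˣ) : Equiv.Perm (almostPos b) where
  toFun x := ⟨tau b ε s x, tau_mem b ε s x.2⟩
  invFun x := ⟨tau b ε s x, tau_mem b ε s x.2⟩
  left_inv x := Subtype.ext (tau_tau b ε s x)
  right_inv x := Subtype.ext (tau_tau b ε s x)

/-- The group `D` of permutations of `Φ_{≥ -1}` generated by `τ₋` and `τ₊`. -/
def D [P.IsRootSystem] [P.IsCrystallographic] [P.IsReduced] [Finite ι]
    (b : P.Base) (ε : (coxeterGraph b).Coloring ℤˣ) : Subgroup (Equiv.Perm (almostPos b)) :=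
  Subgroup.closure {tauPerm b ε (-1), tauPerm b ε 1}

/-- The product `s_{i₁} ⋯ s_{iₖ}` of simple reflections in the Weyl group. -/
def wordProd (b : P.Base) (l : List b.support) : P.weylGroup :=
  (l.map fun i => RootPairing.weylGroup.ofIdx P i).prod

/-- A Coxeter element: the product of all simple reflections, each taken once, in some order. -/
def IsCoxeterElement (b : P.Base) (c : P.weylGroup) : Prop :=
  ∃ l : List b.support, l.Nodup ∧ (∀ i, i ∈ l) ∧ c = wordProd b l

/-- The length of `w`: the least length of a factorization of `w` into simple reflections. -/
def length (b : P.Base) (w : P.weylGroup) : ℕ :=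
  sInf {k | ∃ l : List b.support, l.length = k ∧ w = wordProd b l}

/-- `w` is the longest element of the Weyl group. -/
def IsLongest (b : P.Base) (w : P.weylGroup) : Prop :=
  ∀ v : P.weylGroup, length b v ≤ length b w

/-- `w` acts on the ambient space as `-1`. -/
def IsNegOne (w : P.weylGroup) : Prop := ∀ x : M, w • x = -x

/-- The cyclic group `⟨-w⟩` of linear automorphisms of the ambient space, generated by
`x ↦ -w x`. -/
def negGroup (w : P.weylGroup) : Subgroup (M ≃ₗ[ℝ] M) :=
  Subgroup.zpowers (LinearEquiv.neg ℝ * RootPairing.Equiv.weightHom P w)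

end FZ

end

/-! Write `t₊`, `t₋` for the products of the simple reflections of one colour. On a positive root
`τ_s` acts as `t_s`, and it exchanges the positive and negative versions of the simple roots of
colour `s`. Hence the `D`-orbit of `-αᵢ` is the path `-αᵢ, αᵢ, t αᵢ, t' t αᵢ, …`, with reflections
of alternating colours, up to the first negative root `-αⱼ`; such a root exists since the Coxeter
element `t₋ t₊` fixes only `0`. The Euler form, which `t_s` carries to the form of the opposite
colour, shows that for adjacent `i` the number `h` of reflections taking `αᵢ` to `-αⱼ` is the same,
so by irreducibility it is the same for all `i`. Then the alternating product of `h` factors `t_s`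
sends every `αᵢ` to `-αⱼ`, which makes it the longest element and `h` the order of `t₋ t₊`. All
Coxeter elements are conjugate because the Coxeter graph is a forest, so `h` is the Coxeter number.
The order of `τ₋ τ₊` and the intersection of orbits with `-Π` are read off the paths. -/

noncomputable section

namespace FZ

open Finset Module
open RootPairing.weylGroup (ofIdx)

section Words

variable {I : Type*} {G : SimpleGraph I}

/-- Equivalence of words in the vertices of a graph, generated by cyclic rotations and by
exchanging two neighbouring letters that are not adjacent in the graph. In a Coxeter group, words
equivalent for the Coxeter graph have conjugate products. -/
inductive WordEquiv (G : SimpleGraph I) : List I → List I → Prop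
  | refl (l : List I) : WordEquiv G l l
  | symm {l m : List I} : WordEquiv G l m → WordEquiv G m l
  | trans {k l m : List I} : WordEquiv G k l → WordEquiv G l m → WordEquiv G k m
  | append_comm (l m : List I) : WordEquiv G (l ++ m) (m ++ l)
  | swap (l m : List I) {u v : I} : ¬ G.Adj u v → WordEquiv G (l ++ u :: v :: m) (l ++ v :: u :: m)

/-- A graph is one-degenerate if each nonempty finite set of vertices spans a vertex of degree at
most one; this is the form in which acyclicity of the Coxeter graph is used. -/
def IsOneDegenerate (G : SimpleGraph I) : Prop :=
  ∀ S : Finset I, S.Nonempty → ∃ v ∈ S, (G.neighborSet v ∩ S).Subsingleton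

lemma WordEquiv.perm {l m : List I} (h : WordEquiv G l m) : l.Perm m := by
  induction h with
  | refl l => exact .refl l
  | symm _ ih => exact ih.symm
  | trans _ _ ih₁ ih₂ => exact ih₁.trans ih₂
  | append_comm l m => exact List.perm_append_comm
  | swap l m _ => exact (List.Perm.swap _ _ m).append_left l

lemma WordEquiv.move {v : I} {l : List I} (h : ∀ u ∈ l, ¬ G.Adj v u) (k m : List I) :
    WordEquiv G (k ++ v :: (l ++ m)) (k ++ (l ++ v :: m)) := by
  induction l generalizing k with
  | nil => exact .refl _
  | cons u l ih =>
    rw [List.forall_mem_cons] at h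
    refine (swap k (l ++ m) h.1).trans ?_
    simpa using ih h.2 (k ++ [u])

lemma WordEquiv.cons_append_comm {v : I} {l m : List I} (hlm : (l ++ m).Nodup)
    (hv : (G.neighborSet v ∩ {u | u ∈ l ++ m}).Subsingleton) :
    WordEquiv G (v :: (l ++ m)) (v :: (m ++ l)) := by
  by_cases hl : ∀ u ∈ l, ¬ G.Adj v u
  · refine (move hl [] m).trans ?_
    simpa using append_comm l (v :: m)
  · push Not at hl
    obtain ⟨u, hul, hvu⟩ := hl
    have hm (w : I) (hw : w ∈ m) : ¬ G.Adj v w := fun hvw =>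
      (List.nodup_append.mp hlm).2.2 u hul w hw
        (hv ⟨hvu, List.mem_append_left m hul⟩ ⟨hvw, List.mem_append_right l hw⟩)
    refine WordEquiv.trans ?_ (move hm [] l).symm
    simpa using append_comm (v :: l) m

lemma WordEquiv.cons {v : I} {l m : List I} (h : WordEquiv G l m) (hl : l.Nodup)
    (hv : (G.neighborSet v ∩ {u | u ∈ l}).Subsingleton) : WordEquiv G (v :: l) (v :: m) := by
  induction h with
  | refl l => exact .refl _
  | symm h ih =>
    refine (ih (h.perm.nodup_iff.mpr hl) ?_).symm
    simpa only [h.perm.mem_iff] using hv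
  | trans h _ ih₁ ih₂ =>
    refine (ih₁ hl hv).trans (ih₂ (h.perm.nodup_iff.mp hl) ?_)
    simpa only [h.perm.mem_iff] using hv
  | append_comm l m => exact cons_append_comm hl hv
  | swap l m h => exact swap (v :: l) m h

lemma exists_wordEquiv_cons {v : I} {l : List I} (hv : v ∈ l) : ∃ m, WordEquiv G l (v :: m) := by
  obtain ⟨l₁, l₂, rfl⟩ := List.append_of_mem hv
  exact ⟨l₂ ++ l₁, .append_comm l₁ (v :: l₂)⟩

lemma IsOneDegenerate.wordEquiv_of_perm (hG : IsOneDegenerate G) {l m : List I} (hl : l.Nodup)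
    (hlm : l.Perm m) : WordEquiv G l m := by
  classical
  induction hn : l.length generalizing l m with
  | zero =>
    obtain rfl := List.length_eq_zero_iff.mp hn
    exact hlm.nil_eq ▸ .refl _
  | succ n ih =>
    obtain ⟨v, hvl, hv⟩ := hG l.toFinset (by
      rw [List.toFinset_nonempty_iff]; rintro rfl; simp at hn)
    rw [List.mem_toFinset] at hvl
    rw [List.coe_toFinset] at hv
    obtain ⟨l', hl'⟩ := exists_wordEquiv_cons (G := G) hvl
    obtain ⟨m', hm'⟩ := exists_wordEquiv_cons (G := G) (hlm.mem_iff.mp hvl)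
    have hnd : l'.Nodup := (hl'.perm.nodup_iff.mp hl).of_cons
    have hlen : l'.length = n := by simpa [hn] using hl'.perm.length_eq.symm
    have hsub : {u | u ∈ l'} ⊆ {u | u ∈ l} := fun u hu =>
      hl'.perm.mem_iff.mpr (List.mem_cons_of_mem v hu)
    have hperm : l'.Perm m' := (hl'.symm.perm.trans (hlm.trans hm'.perm)).cons_inv
    have hcons : WordEquiv G (v :: l') (v :: m') :=
      (ih hnd hperm hlen).cons hnd (hv.anti (Set.inter_subset_inter_right _ hsub))
    exact (hl'.trans hcons).trans hm'.symm

lemma WordEquiv.isConj_prod {H : Type*} [Group H] {f : I → H}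
    (hf : ∀ u v, ¬ G.Adj u v → Commute (f u) (f v)) {l m : List I} (h : WordEquiv G l m) :
    IsConj (l.map f).prod (m.map f).prod := by
  induction h with
  | refl l => exact .refl _
  | symm _ ih => exact ih.symm
  | trans _ _ ih₁ ih₂ => exact ih₁.trans ih₂
  | append_comm l m =>
    rw [List.map_append, List.map_append, List.prod_append, List.prod_append]
    exact isConj_iff.mpr ⟨(l.map f).prod⁻¹, by group⟩
  | swap l m h =>
    simp only [List.map_append, List.map_cons, List.prod_append, List.prod_cons]
    rw [(hf _ _ h).left_comm]

end Words

section AlternatingProduct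

variable {H : Type*}

/-- The alternating product `⋯ t s * t (-s) * t s` with `k` factors, the rightmost being `t s`. -/
def altProd [Monoid H] (t : ℤˣ → H) (s : ℤˣ) : ℕ → H
  | 0 => 1
  | k + 1 => t (s * (-1) ^ k) * altProd t s k

section Monoid

variable [Monoid H] (t : ℤˣ → H) (s : ℤˣ)

lemma altProd_zero : altProd t s 0 = 1 := rfl

lemma altProd_succ (k : ℕ) : altProd t s (k + 1) = t (s * (-1) ^ k) * altProd t s k := rfl

lemma altProd_add (k m : ℕ) :
    altProd t s (k + m) = altProd t (s * (-1) ^ m) k * altProd t s m := by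
  induction k with
  | zero => simp [altProd_zero]
  | succ k ih =>
    rw [Nat.succ_add, altProd_succ, ih, altProd_succ, mul_assoc, mul_assoc, pow_add,
      mul_comm ((-1) ^ k)]

lemma altProd_succ' (k : ℕ) : altProd t s (k + 1) = altProd t (-s) k * t s := by
  rw [altProd_add, altProd_succ, altProd_zero, pow_zero, pow_one, mul_one, mul_one, mul_neg_one]

lemma altProd_two_mul (k : ℕ) : altProd t s (2 * k) = (t (-s) * t s) ^ k := by
  induction k with
  | zero => rw [mul_zero, altProd_zero, pow_zero]
  | succ k ih =>
    rw [Nat.mul_succ, altProd_succ', altProd_succ', neg_neg, ih, pow_succ, mul_assoc]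

end Monoid

section Group

variable [Group H]

lemma orderOf_mul_neg (t : ℤˣ → H) (s : ℤˣ) : orderOf (t (-s) * t s) = orderOf (t (-1) * t 1) := by
  rcases Int.units_eq_one_or s with rfl | rfl
  · rfl
  · rw [neg_neg]
    exact SemiconjBy.orderOf_eq (t (-1)) (mul_assoc _ _ _).symm

lemma altProd_two_mul_eq_one_iff (t : ℤˣ → H) (s : ℤˣ) (k : ℕ) :
    altProd t s (2 * k) = 1 ↔ orderOf (t (-1) * t 1) ∣ k := by
  rw [altProd_two_mul, ← orderOf_mul_neg t s, orderOf_dvd_iff_pow_eq_one]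

end Group

end AlternatingProduct

section Involutions

variable {H : Type*} [Group H] {a c g : H}

lemma semiconjBy_mul_inv_left (ha : a * a = 1) (hc : c * c = 1) :
    SemiconjBy a (a * c) (a * c)⁻¹ := by
  rw [SemiconjBy, mul_inv_rev, inv_mul_cancel_right, ← mul_assoc, ha, one_mul,
    inv_eq_of_mul_eq_one_left hc]

lemma semiconjBy_mul_inv_right (ha : a * a = 1) (hc : c * c = 1) :
    SemiconjBy c (a * c) (a * c)⁻¹ := by
  rw [SemiconjBy, mul_inv_rev, inv_eq_of_mul_eq_one_left ha, inv_eq_of_mul_eq_one_left hc,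
    ← mul_assoc]

/-- The homomorphism from a dihedral group which sends the rotation `r 1` to `g` and the
reflection `sr 0` to `a`. -/
def dihedralLift {n : ℕ} (ha : a * a = 1) (hg : g ^ n = 1) (hag : SemiconjBy a g g⁻¹) :
    DihedralGroup n →* H :=
  let rot : ZMod n → H := fun i => (ZMod.lift n ⟨zmultiplesHom (Additive H) (.ofMul g), by
    simp [← ofMul_pow, hg]⟩ i).toMul
  have rot_coe (k : ℤ) : rot k = g ^ k := by simp [rot]
  have zpow_mul_left (k : ℤ) : g ^ k * a = a * g ^ (-k) := by
    simpa using ((hag.zpow_right k).inv_right.eq).symm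
  { toFun := fun
      | .r i => rot i
      | .sr i => a * rot i
    map_one' := (congrArg rot Int.cast_zero.symm).trans ((rot_coe 0).trans (zpow_zero g))
    map_mul' := by
      rintro (i | i) (j | j) <;> obtain ⟨k, rfl⟩ := ZMod.intCast_surjective i <;>
        obtain ⟨l, rfl⟩ := ZMod.intCast_surjective j
      · simp only [DihedralGroup.r_mul_r, ← Int.cast_add, rot_coe, zpow_add]
      · simp only [DihedralGroup.r_mul_sr, ← Int.cast_sub, rot_coe]
        rw [← mul_assoc, zpow_mul_left, mul_assoc, ← zpow_add, neg_add_eq_sub]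
      · simp only [DihedralGroup.sr_mul_r, ← Int.cast_add, rot_coe, zpow_add, mul_assoc]
      · simp only [DihedralGroup.sr_mul_sr, ← Int.cast_sub, rot_coe]
        rw [mul_assoc, ← mul_assoc (g ^ k), zpow_mul_left, mul_assoc, ← mul_assoc a, ha, one_mul,
          ← zpow_add, neg_add_eq_sub] }

section DihedralLift

variable {n : ℕ} (ha : a * a = 1) (hg : g ^ n = 1) (hag : SemiconjBy a g g⁻¹)

lemma dihedralLift_r_intCast (k : ℤ) : dihedralLift ha hg hag (.r k) = g ^ k :=
  (congrArg Additive.toMul (ZMod.lift_coe n _ k)).trans (by simp)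

lemma dihedralLift_sr_intCast (k : ℤ) : dihedralLift ha hg hag (.sr k) = a * g ^ k :=
  congrArg (a * ·) (dihedralLift_r_intCast ha hg hag k)

lemma dihedralLift_injective (hgn : orderOf g = n) (hag' : a ∉ Subgroup.zpowers g) :
    Function.Injective (dihedralLift ha hg hag) := by
  rw [injective_iff_map_eq_one]
  rintro (i | i) hi <;> obtain ⟨k, rfl⟩ := ZMod.intCast_surjective i
  · rw [dihedralLift_r_intCast, ← orderOf_dvd_iff_zpow_eq_one, hgn,
      ← ZMod.intCast_zmod_eq_zero_iff_dvd] at hi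
    rw [hi, DihedralGroup.one_def]
  · rw [dihedralLift_sr_intCast, mul_eq_one_iff_eq_inv, ← zpow_neg] at hi
    exact absurd ⟨-k, hi.symm⟩ hag'

lemma range_dihedralLift : (dihedralLift ha hg hag).range = Subgroup.closure {a, a * g} := by
  apply le_antisymm
  · have haD : a ∈ Subgroup.closure {a, a * g} := Subgroup.subset_closure (Set.mem_insert _ _)
    have hgD : g ∈ Subgroup.closure {a, a * g} := by
      simpa [← mul_assoc, ha] using
        mul_mem haD (Subgroup.subset_closure (Set.mem_insert_of_mem a rfl))
    rintro _ ⟨i | i, rfl⟩ <;> obtain ⟨k, rfl⟩ := ZMod.intCast_surjective i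
    · rw [dihedralLift_r_intCast]
      exact zpow_mem hgD k
    · rw [dihedralLift_sr_intCast]
      exact mul_mem haD (zpow_mem hgD k)
  · rw [Subgroup.closure_le]
    rintro x (rfl | rfl)
    · exact ⟨.sr (0 : ℤ), by rw [dihedralLift_sr_intCast, zpow_zero, mul_one]⟩
    · exact ⟨.sr (1 : ℤ), by rw [dihedralLift_sr_intCast, zpow_one]⟩

end DihedralLift

lemma closure_pair_dihedral (ha : a * a = 1) (hc : c * c = 1) (hac : a * c ≠ c * a) :
    Nat.card (Subgroup.closure {a, c}) = 2 * orderOf (a * c) ∧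
      Nonempty (Subgroup.closure {a, c} ≃* DihedralGroup (orderOf (a * c))) := by
  have hsemi := semiconjBy_mul_inv_left ha hc
  have hnot : a ∉ Subgroup.zpowers (a * c) := by
    rintro ⟨k, hk : (a * c) ^ k = a⟩
    have hcomm : Commute ((a * c) ^ k) (a * c) := (Commute.refl (a * c)).zpow_left k
    rw [hk] at hcomm
    exact hac (mul_left_cancel (hcomm.eq.trans (mul_assoc a c a)))
  have hrange := range_dihedralLift ha (pow_orderOf_eq_one (a * c)) hsemi
  rw [← mul_assoc, ha, one_mul] at hrange
  have e : DihedralGroup (orderOf (a * c)) ≃* Subgroup.closure {a, c} :=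
    (MonoidHom.ofInjective (dihedralLift_injective ha _ hsemi rfl hnot)).trans
      (MulEquiv.subgroupCongr hrange)
  exact ⟨(Nat.card_congr e.toEquiv).symm.trans DihedralGroup.nat_card, ⟨e.symm⟩⟩

end Involutions

section Orbits

open scoped Pointwise

variable {H X : Type*} [Group H] [MulAction H X]

lemma orbit_closure_subset {A : Set H} (hA : ∀ a ∈ A, a * a = 1) {S : Set X}
    (hS : ∀ a ∈ A, ∀ x ∈ S, a • x ∈ S) {x : X} (hx : x ∈ S) :
    MulAction.orbit (Subgroup.closure A) x ⊆ S := by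
  have hle : Subgroup.closure A ≤ MulAction.stabilizer H S := by
    refine (Subgroup.closure_le _).mpr fun a ha => MulAction.mem_stabilizer_set.mpr fun y =>
      ⟨fun hy => ?_, hS a ha y⟩
    simpa only [smul_smul, hA a ha, one_smul] using hS a ha _ hy
  rintro _ ⟨⟨g, hg⟩, rfl⟩
  exact (MulAction.mem_stabilizer_set.mp (hle hg) x).mpr hx

lemma pow_smul_eq_of_mem_orbit_closure {a c : H} (ha : a * a = 1) (hc : c * c = 1) {m : ℕ}
    {x y : X} (hx : (a * c) ^ m • x = x) (hy : y ∈ MulAction.orbit (Subgroup.closure {a, c}) x) :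
    (a * c) ^ m • y = y := by
  have hfix {g : H} (hg : SemiconjBy g (a * c) (a * c)⁻¹) {z : X} (hz : (a * c) ^ m • z = z) :
      (a * c) ^ m • g • z = g • z := by
    have hinv : ((a * c)⁻¹) ^ m • z = z := by rw [inv_pow, inv_smul_eq_iff, hz]
    have hpow := (hg.inv_right.pow_right m).eq
    rw [inv_inv] at hpow
    rw [← mul_smul, ← hpow, mul_smul, hinv]
  refine orbit_closure_subset (S := {z | (a * c) ^ m • z = z}) ?_ ?_ hx hy
  · rintro g (rfl | rfl) <;> assumption
  · rintro g (rfl | rfl) z hz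
    · exact hfix (semiconjBy_mul_inv_left ha hc) hz
    · exact hfix (semiconjBy_mul_inv_right ha hc) hz

lemma bijOn_image_orbit_inter {K Y : Type*} [Group K] [MulAction K Y] {e : X → Y}
    (he : Function.Injective e) {S : Set Y} (hSe : S ⊆ Set.range e)
    (hmeet : ∀ x, ∃ z ∈ MulAction.orbit H x, e z ∈ S)
    (horb : ∀ x, e x ∈ S → e '' MulAction.orbit H x ∩ S = MulAction.orbit K (e x)) :
    Set.BijOn (fun Ω : Set X => e '' Ω ∩ S) {Ω | ∃ x, Ω = MulAction.orbit H x}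
      {O : Set Y | ∃ y ∈ S, O = MulAction.orbit K y} := by
  refine ⟨?_, ?_, ?_⟩
  · rintro _ ⟨x, rfl⟩
    obtain ⟨z, hz, hzS⟩ := hmeet x
    refine ⟨e z, hzS, ?_⟩
    rw [← horb z hzS, MulAction.orbit_eq_iff.mpr hz]
  · rintro _ ⟨x, rfl⟩ _ ⟨y, rfl⟩ hxy
    obtain ⟨z, hz, hzS⟩ := hmeet x
    obtain ⟨z', hz', hzz'⟩ := (hxy.subset ⟨⟨z, hz, rfl⟩, hzS⟩).1
    rw [he hzz'] at hz'
    rw [← MulAction.orbit_eq_iff.mpr hz, MulAction.orbit_eq_iff.mpr hz']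
  · rintro _ ⟨y, hy, rfl⟩
    obtain ⟨x, rfl⟩ := hSe hy
    exact ⟨_, ⟨x, rfl⟩, horb x hy⟩

end Orbits

section Bilinear

/-- Some row of the Gram matrix of the vectors `v i` with `i ∈ S` has positive sum, which leaves
room for at most one entry `≤ -1/2`. -/
lemma exists_subsingleton_setOf_le_neg_half {E κ : Type*} [AddCommGroup E] [Module ℝ E]
    (B : LinearMap.BilinForm ℝ E) {v : κ → E} (hv : ∀ i, B (v i) (v i) = 1)
    (hle : ∀ i j, i ≠ j → B (v i) (v j) ≤ 0) {S : Finset κ}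
    (hS : 0 < B (∑ i ∈ S, v i) (∑ i ∈ S, v i)) :
    ∃ i ∈ S, ({j | B (v i) (v j) ≤ -1 / 2} ∩ S : Set κ).Subsingleton := by
  classical
  obtain ⟨i, hi, hrow⟩ : ∃ i ∈ S, 0 < ∑ j ∈ S, B (v i) (v j) := by
    by_contra! hcon
    rw [map_sum B v S, LinearMap.sum_apply] at hS
    exact hS.not_ge (sum_nonpos fun i hi => (map_sum (B (v i)) v S).trans_le (hcon i hi))
  refine ⟨i, hi, ?_⟩
  rintro a ⟨hia, ha⟩ c ⟨hic, hc⟩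
  rw [Set.mem_ofPred_eq] at hia hic
  by_contra hac
  have hne {j : κ} (hj : B (v i) (v j) ≤ -1 / 2) : i ≠ j := by
    rintro rfl
    linarith [hv i]
  have hsub : {i, a, c} ⊆ S := by
    simp only [insert_subset_iff, singleton_subset_iff]
    exact ⟨hi, ha, hc⟩
  have hrest : ∑ j ∈ S \ {i, a, c}, B (v i) (v j) ≤ 0 := by
    refine sum_nonpos fun j hj => hle i j ?_
    rintro rfl
    simp at hj
  have hthree : ∑ j ∈ {i, a, c}, B (v i) (v j) = 1 + B (v i) (v a) + B (v i) (v c) := by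
    rw [sum_insert (by simp [hne hia, hne hic]), sum_pair hac, hv, add_assoc]
  rw [← sum_sdiff hsub, hthree] at hrow
  linarith

end Bilinear

variable {ι M N : Type*} [AddCommGroup M] [Module ℝ M] [AddCommGroup N] [Module ℝ N]
  {P : RootPairing ι ℝ M N}

section Coefficients

variable [P.IsRootSystem] (b : P.Base)

lemma coeff_neg (x : M) (i : b.support) : coeff b (-x) i = -coeff b x i := by
  simp only [coeff, map_neg, Finsupp.neg_apply]

lemma coeff_sum_smul {κ : Type*} (s : Finset κ) (r : κ → ℝ) (f : κ → M) (i : b.support) :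
    coeff b (∑ k ∈ s, r k • f k) i = ∑ k ∈ s, r k * coeff b (f k) i := by
  simp [coeff]

lemma coeff_zero (i : b.support) : coeff b (0 : M) i = 0 := by
  simp only [coeff, map_zero, Finsupp.zero_apply]

open Classical in
lemma coeff_simpleRoot (i j : b.support) : coeff b (P.root j) i = if j = i then 1 else 0 := by
  rw [coeff, b.toWeightBasis_repr_root, Finsupp.single_apply]

lemma sum_coeff_smul_root (x : M) : ∑ i, coeff b x i • P.root i = x := by
  simpa only [coeff, b.toWeightBasis_apply] using b.toWeightBasis.sum_repr x

lemma coroot'_eq_sum_cartan_mul_coeff (i : b.support) (x : M) :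
    P.coroot' i x = ∑ j, cartan b i j * coeff b x j := by
  conv_lhs => rw [← sum_coeff_smul_root b x]
  simp [cartan, mul_comm]

lemma eq_zero_of_forall_coroot'_eq_zero {x : M} (h : ∀ i : b.support, P.coroot' i x = 0) :
    x = 0 := by
  refine (LinearMap.map_eq_zero_iff _ P.toPerfPair.injective).mp ?_
  refine b.toCoweightBasis.ext fun i => ?_
  rw [b.toCoweightBasis_apply, LinearMap.zero_apply]
  exact h i

end Coefficients

/-- A vector of the ambient space is a positive root. -/
def IsPosRoot (b : P.Base) (x : M) : Prop := ∃ k, b.IsPos k ∧ x = P.root k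

section PosRoot

variable (b : P.Base)

lemma isPosRoot_simpleRoot (i : b.support) : IsPosRoot b (P.root i) :=
  ⟨i, b.isPos_of_mem_support i.2, rfl⟩

lemma isPosRoot_or_neg (k : ι) : IsPosRoot b (P.root k) ∨ IsPosRoot b (-P.root k) :=
  (RootPairing.Base.IsPos.or_neg b k).imp (fun h => ⟨k, h, rfl⟩) fun h => ⟨_, h, by simp⟩

lemma isPosRoot_smul_or_neg (w : P.weylGroup) (k : ι) :
    IsPosRoot b (w • P.root k) ∨ IsPosRoot b (-(w • P.root k)) := by
  rw [P.weylGroup_apply_root]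
  exact isPosRoot_or_neg b _

variable {b}

lemma isPosRoot_ofIdx_smul [Finite ι] [P.IsCrystallographic] [P.IsReduced] {x : M}
    (hx : IsPosRoot b x) (i : b.support) (hi : x ≠ P.root i) :
    IsPosRoot b (ofIdx P (i : ι) • x) := by
  obtain ⟨k, hk, rfl⟩ := hx
  exact ⟨P.reflectionPerm i k, hk.reflectionPerm i.2 fun h => hi (congrArg P.root h), by simp⟩

variable [P.IsRootSystem]

lemma IsPosRoot.coeff_nonneg {x : M} (h : IsPosRoot b x) (i : b.support) : 0 ≤ coeff b x i := by
  obtain ⟨k, hk, rfl⟩ := h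
  exact coeff_root_nonneg b hk i

lemma IsPosRoot.exists_coeff_pos {x : M} (h : IsPosRoot b x) : ∃ i, 0 < coeff b x i := by
  by_contra! hle
  have hx : x = 0 := coeff_ext b fun i => by
    rw [coeff_zero]
    exact le_antisymm (hle i) (h.coeff_nonneg i)
  obtain ⟨k, -, rfl⟩ := h
  exact P.ne_zero k hx

lemma not_isPosRoot_of_coeff_nonpos {x : M} (h : ∀ i, coeff b x i ≤ 0) : ¬ IsPosRoot b x :=
  fun hx => hx.exists_coeff_pos.elim fun i hi => (h i).not_gt hi

lemma IsPosRoot.not_neg {x : M} (h : IsPosRoot b x) : ¬ IsPosRoot b (-x) :=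
  not_isPosRoot_of_coeff_nonpos fun i => by
    rw [coeff_neg]
    exact neg_nonpos.mpr (h.coeff_nonneg i)

lemma isPosRoot_neg_smul {w : P.weylGroup} (h : ∀ i : b.support, ¬ IsPosRoot b (w • P.root i))
    {x : M} (hx : IsPosRoot b x) : IsPosRoot b (-(w • x)) := by
  have hsimple (i j : b.support) : coeff b (w • P.root i) j ≤ 0 := by
    have hneg := ((isPosRoot_smul_or_neg b w i).resolve_left (h i)).coeff_nonneg j
    rwa [coeff_neg, neg_nonneg] at hneg
  have hle (j : b.support) : coeff b (w • x) j ≤ 0 := by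
    rw [← sum_coeff_smul_root b x, Finset.smul_sum]
    simp only [smul_comm w]
    rw [coeff_sum_smul]
    exact sum_nonpos fun i _ => mul_nonpos_of_nonneg_of_nonpos (hx.coeff_nonneg i) (hsimple i j)
  obtain ⟨k, -, rfl⟩ := hx
  exact (isPosRoot_smul_or_neg b w k).resolve_left (not_isPosRoot_of_coeff_nonpos hle)

end PosRoot

section WeylGroup

lemma weylGroup_ext {w v : P.weylGroup} (h : ∀ x : M, w • x = v • x) : w = v :=
  Subtype.ext (RootPairing.Equiv.weightHom_injective P (LinearEquiv.ext h))

lemma ofIdx_mul_self (i : ι) : ofIdx P i * ofIdx P i = 1 :=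
  weylGroup_ext fun x => by simp [mul_smul]

lemma ofIdx_mul_ofIdx_mul_ofIdx (i k : ι) :
    ofIdx P i * ofIdx P k * ofIdx P i = ofIdx P (P.reflectionPerm i k) :=
  weylGroup_ext fun x => by
    simp [mul_smul, RootPairing.reflection_reflectionPerm]

lemma mul_ofIdx_mul_inv (w : P.weylGroup) (k : ι) :
    w * ofIdx P k * w⁻¹ = ofIdx P (P.weylGroupToPerm w k) := by
  obtain ⟨w, hw⟩ := w
  induction hw using RootPairing.weylGroup.induction generalizing k with
  | mem i =>
    have hinv : (ofIdx P i)⁻¹ = ofIdx P i := inv_eq_of_mul_eq_one_left (ofIdx_mul_self i)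
    have h := ofIdx_mul_ofIdx_mul_ofIdx (P := P) i k
    nth_rw 2 [← hinv] at h
    exact h
  | one =>
    have hone : (⟨1, one_mem _⟩ : P.weylGroup) = 1 := rfl
    rw [hone, map_one, one_mul, inv_one, mul_one, Equiv.Perm.one_apply]
  | mul w v hw hv ihw ihv =>
    have hsplit : (⟨w * v, mul_mem hw hv⟩ : P.weylGroup) = ⟨w, hw⟩ * ⟨v, hv⟩ := rfl
    rw [hsplit, map_mul, Equiv.Perm.mul_apply, ← ihw, ← ihv]
    group

lemma mul_ofIdx_eq_ofIdx_mul {w : P.weylGroup} {k j : ι} (h : w • P.root k = P.root j) :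
    w * ofIdx P k = ofIdx P j * w := by
  rw [P.weylGroup_apply_root] at h
  rw [← P.root.injective h, ← mul_ofIdx_mul_inv, inv_mul_cancel_right]

lemma wordProd_eq_prod_map (b : P.Base) (l : List b.support) :
    wordProd b l = (l.map fun i : b.support => ofIdx P (i : ι)).prod := by
  simp [wordProd]

lemma wordProd_cons (b : P.Base) (i : b.support) (l : List b.support) :
    wordProd b (i :: l) = ofIdx P (i : ι) * wordProd b l := by
  simp only [wordProd_eq_prod_map, List.map_cons, List.prod_cons]

lemma wordProd_append (b : P.Base) (l m : List b.support) :
    wordProd b (l ++ m) = wordProd b l * wordProd b m := by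
  simp only [wordProd_eq_prod_map, List.map_append, List.prod_append]

lemma wordProd_singleton (b : P.Base) (i : b.support) :
    wordProd b [i] = ofIdx P (i : ι) := by
  simp only [wordProd_eq_prod_map, List.map_singleton, List.prod_singleton]

variable [Finite ι] [P.IsCrystallographic] [P.IsReduced]

lemma exists_wordProd_eq_ofIdx (b : P.Base) (k : ι) : ∃ l, wordProd b l = ofIdx P k := by
  refine b.induction_reflect k (p := fun k => ∃ l, wordProd b l = ofIdx P k) ?_ ?_ ?_
  · rintro i ⟨l, hl⟩
    exact ⟨l, by rw [← ofIdx_mul_ofIdx_mul_ofIdx, ofIdx_mul_self, one_mul, hl]⟩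
  · exact fun i hi => ⟨[⟨i, hi⟩], wordProd_singleton b _⟩
  · rintro i j ⟨l, hl⟩ hj
    refine ⟨⟨j, hj⟩ :: (l ++ [⟨j, hj⟩]), ?_⟩
    rw [wordProd_cons, wordProd_append, wordProd_singleton, hl, ← ofIdx_mul_ofIdx_mul_ofIdx,
      mul_assoc]

lemma exists_wordProd_eq (b : P.Base) (w : P.weylGroup) : ∃ l, w = wordProd b l := by
  obtain ⟨w, hw⟩ := w
  induction hw using RootPairing.weylGroup.induction with
  | mem i =>
    obtain ⟨l, hl⟩ := exists_wordProd_eq_ofIdx b i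
    exact ⟨l, hl.symm⟩
  | one => exact ⟨[], rfl⟩
  | mul w v hw hv ihw ihv =>
    obtain ⟨l, hl⟩ := ihw
    obtain ⟨m, hm⟩ := ihv
    exact ⟨l ++ m, by rw [wordProd_append, ← hl, ← hm]; rfl⟩

end WeylGroup

section Length

lemma length_wordProd_le (b : P.Base) (l : List b.support) :
    length b (wordProd b l) ≤ l.length :=
  Nat.sInf_le ⟨l, rfl, rfl⟩

variable [Finite ι] [P.IsCrystallographic] [P.IsReduced] (b : P.Base)

lemma exists_wordProd_mul_ofIdx_eq (l : List b.support) (i : b.support)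
    (h : ¬ IsPosRoot b (wordProd b l • P.root i)) :
    ∃ m : List b.support, m.length + 1 = l.length ∧
      wordProd b l * ofIdx P (i : ι) = wordProd b m := by
  induction l with
  | nil => exact absurd (by simpa [wordProd] using isPosRoot_simpleRoot b i) h
  | cons a l ih =>
    by_cases hl : IsPosRoot b (wordProd b l • P.root i)
    · have ha : wordProd b l • P.root i = P.root a := by
        by_contra hne
        rw [wordProd_cons, mul_smul] at h
        exact h (isPosRoot_ofIdx_smul hl a hne)
      refine ⟨l, rfl, ?_⟩
      rw [wordProd_cons, mul_assoc, mul_ofIdx_eq_ofIdx_mul ha, ← mul_assoc, ofIdx_mul_self, one_mul]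
    · obtain ⟨m, hm, hm'⟩ := ih hl
      exact ⟨a :: m, by rw [List.length_cons, List.length_cons, hm],
        by rw [wordProd_cons, wordProd_cons, mul_assoc, hm']⟩

lemma exists_length_eq (w : P.weylGroup) :
    ∃ l : List b.support, l.length = length b w ∧ w = wordProd b l := by
  obtain ⟨l, hl⟩ := exists_wordProd_eq b w
  exact Nat.sInf_mem (s := {k | ∃ l : List b.support, l.length = k ∧ w = wordProd b l})
    ⟨_, l, rfl, hl⟩

lemma length_mul_ofIdx_lt {w : P.weylGroup} {i : b.support} (h : ¬ IsPosRoot b (w • P.root i)) :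
    length b (w * ofIdx P (i : ι)) < length b w := by
  obtain ⟨l, hl, rfl⟩ := exists_length_eq b w
  obtain ⟨m, hm, hm'⟩ := exists_wordProd_mul_ofIdx_eq b l i h
  have hle := length_wordProd_le b m
  rw [hm']
  lia

variable [P.IsRootSystem]

lemma length_lt_mul_ofIdx {w : P.weylGroup} {i : b.support} (h : IsPosRoot b (w • P.root i)) :
    length b w < length b (w * ofIdx P (i : ι)) := by
  have h' : ¬ IsPosRoot b ((w * ofIdx P (i : ι)) • P.root i) := by
    have hneg : ofIdx P (i : ι) • P.root i = -P.root i := P.reflection_apply_self i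
    rw [mul_smul, hneg, smul_neg]
    exact h.not_neg
  simpa only [mul_assoc, ofIdx_mul_self, mul_one] using length_mul_ofIdx_lt b h'

variable {b}

lemma IsLongest.not_isPosRoot {w : P.weylGroup} (hw : IsLongest b w) (i : b.support) :
    ¬ IsPosRoot b (w • P.root i) := fun h => (hw _).not_gt (length_lt_mul_ofIdx b h)

lemma eq_one_of_isPosRoot {w : P.weylGroup} (h : ∀ i : b.support, IsPosRoot b (w • P.root i)) :
    w = 1 := by
  obtain ⟨l, hl, rfl⟩ := exists_length_eq b w
  rcases l.eq_nil_or_concat' with rfl | ⟨m, i, rfl⟩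
  · rfl
  · exfalso
    have hlt := length_lt_mul_ofIdx b (h i)
    rw [← hl, wordProd_append, wordProd_singleton, mul_assoc, ofIdx_mul_self, mul_one,
      List.length_append, List.length_singleton] at hlt
    have hle := length_wordProd_le b m
    lia

lemma eq_of_forall_not_isPosRoot {w v : P.weylGroup}
    (hw : ∀ i : b.support, ¬ IsPosRoot b (w • P.root i))
    (hv : ∀ i : b.support, ¬ IsPosRoot b (v • P.root i)) : w = v := by
  suffices v⁻¹ * w = 1 from (inv_mul_eq_one.mp this).symm
  refine eq_one_of_isPosRoot (b := b) fun i => ?_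
  by_contra hn
  have hpos := isPosRoot_neg_smul hv ((isPosRoot_smul_or_neg b (v⁻¹ * w) i).resolve_left hn)
  rw [smul_neg, neg_neg, smul_smul, mul_inv_cancel_left] at hpos
  exact hw i hpos

end Length

section Cartan

variable (b : P.Base)

lemma cartan_self (i : b.support) : cartan b i i = 2 := P.pairing_same i

variable [P.IsCrystallographic]

lemma cartan_eq_intCast (i j : b.support) : cartan b i j = (P.pairingIn ℤ j i : ℤ) := by
  simp [cartan, ← P.algebraMap_pairingIn ℤ]

lemma one_le_cartan_mul_cartan {i j : b.support} (h : (coxeterGraph b).Adj i j) :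
    1 ≤ cartan b i j * cartan b j i := by
  have hpos := h.2
  rw [cartan_eq_intCast, cartan_eq_intCast] at hpos ⊢
  exact_mod_cast hpos

variable [Finite ι]

lemma cartan_nonpos {i j : b.support} (h : i ≠ j) : cartan b i j ≤ 0 := by
  rw [cartan_eq_intCast]
  exact_mod_cast b.pairingIn_le_zero_of_ne (fun h' => h (Subtype.ext h'.symm)) j.2 i.2

lemma cartan_neg_of_adj {i j : b.support} (h : (coxeterGraph b).Adj i j) : cartan b i j < 0 :=
  (cartan_nonpos b h.1).lt_of_ne fun h0 => h.2.ne' (by rw [h0, zero_mul])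

lemma isOrthogonal_of_not_adj {i j : b.support} (hij : i ≠ j) (h : ¬ (coxeterGraph b).Adj i j) :
    P.IsOrthogonal i j := by
  rw [P.isOrthogonal_symm, P.isOrthogonal_iff_pairing_eq_zero]
  by_contra hne
  have hne' : P.pairing i j ≠ 0 := fun h0 => hne (P.pairing_eq_zero_iff.mp h0)
  exact h ⟨hij, mul_pos_of_neg_of_neg ((cartan_nonpos b hij).lt_of_ne hne)
    ((cartan_nonpos b hij.symm).lt_of_ne hne')⟩

lemma commute_ofIdx_of_not_adj {i j : b.support} (h : ¬ (coxeterGraph b).Adj i j) :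
    Commute (ofIdx P (i : ι)) (ofIdx P (j : ι)) := by
  by_cases hij : i = j
  · rw [hij]
  · exact weylGroup_ext fun x =>
      LinearEquiv.congr_fun (P.isOrthogonal_comm i j (isOrthogonal_of_not_adj b hij h)).eq x

end Cartan

section InvariantForm

variable [Finite ι] [P.IsRootSystem]

variable (P) in
lemma exists_posDef_invariantForm :
    ∃ B : P.InvariantForm, ∀ x : M, x ≠ 0 → 0 < B.form x x := by
  have := Fintype.ofFinite ι
  exact ⟨P.toInvariantForm, fun x => P.rootForm_pos_of_ne_zero (by simp)⟩

/-- A symmetrizer of the Cartan matrix. -/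
def IsSymmetrizer (b : P.Base) (d : b.support → ℝ) : Prop :=
  (∀ i, 0 < d i) ∧ ∀ i j, d i * cartan b i j = d j * cartan b j i

lemma exists_isSymmetrizer (b : P.Base) : ∃ d, IsSymmetrizer b d := by
  obtain ⟨B, hB⟩ := exists_posDef_invariantForm P
  refine ⟨fun i => B.form (P.root i) (P.root i), fun i => hB _ (P.ne_zero i), fun i j => ?_⟩
  simpa only [cartan, mul_comm] using B.pairing_mul_eq_pairing_mul_swap i j

end InvariantForm

section UnitRoot

/-- The positive multiple of a root which has length one for a positive invariant form. -/
def unitRoot (B : P.InvariantForm) (i : ι) : M := (√(B.form (P.root i) (P.root i)))⁻¹ • P.root i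

variable {B : P.InvariantForm}

lemma form_unitRoot (i j : ι) :
    B.form (unitRoot B i) (unitRoot B j) = (√(B.form (P.root i) (P.root i)))⁻¹ *
      (√(B.form (P.root j) (P.root j)))⁻¹ * B.form (P.root i) (P.root j) := by
  simp only [unitRoot, map_smul, LinearMap.smul_apply, smul_eq_mul]
  ring

variable (hB : ∀ x : M, x ≠ 0 → 0 < B.form x x)
include hB

lemma form_unitRoot_self (i : ι) : B.form (unitRoot B i) (unitRoot B i) = 1 := by
  have hi := hB _ (P.ne_zero i)
  rw [form_unitRoot, ← mul_inv, Real.mul_self_sqrt hi.le, inv_mul_cancel₀ hi.ne']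

lemma four_mul_form_unitRoot_sq (i j : ι) :
    4 * B.form (unitRoot B i) (unitRoot B j) ^ 2 = P.pairing i j * P.pairing j i := by
  have hi := hB _ (P.ne_zero i)
  have hj := hB _ (P.ne_zero j)
  have hij := B.two_mul_apply_root_root i j
  have hji := B.two_mul_apply_root_root j i
  rw [← B.symm.eq, RingHom.id_apply] at hji
  rw [form_unitRoot, mul_pow, mul_pow, inv_pow, inv_pow, Real.sq_sqrt hi.le, Real.sq_sqrt hj.le]
  field_simp
  linear_combination 2 * B.form (P.root i) (P.root j) * hij +
    P.pairing i j * B.form (P.root j) (P.root j) * hji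

variable [Finite ι] [P.IsCrystallographic] {b : P.Base}

lemma form_unitRoot_nonpos {i j : b.support} (hij : i ≠ j) :
    B.form (unitRoot B i) (unitRoot B j) ≤ 0 := by
  have hj := hB _ (P.ne_zero j)
  have hroot : B.form (P.root i) (P.root j) ≤ 0 := by
    have hmul := B.two_mul_apply_root_root i j
    have hle := mul_nonpos_of_nonpos_of_nonneg (cartan_nonpos b hij.symm) hj.le
    rw [cartan, ← hmul] at hle
    linarith
  rw [form_unitRoot]
  exact mul_nonpos_of_nonneg_of_nonpos (by positivity) hroot

lemma form_unitRoot_le_of_adj {i j : b.support} (hij : (coxeterGraph b).Adj i j) :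
    B.form (unitRoot B i) (unitRoot B j) ≤ -1 / 2 := by
  have hsq := four_mul_form_unitRoot_sq hB (i : ι) j
  have hge := one_le_cartan_mul_cartan b hij.symm
  rw [cartan, cartan, ← hsq] at hge
  nlinarith [form_unitRoot_nonpos hB hij.1]

end UnitRoot

section CoxeterElement

variable [Finite ι] [P.IsCrystallographic] [P.IsRootSystem] {b : P.Base}

variable (b) in
lemma isOneDegenerate_coxeterGraph : IsOneDegenerate (coxeterGraph b) := by
  classical
  obtain ⟨B, hB⟩ := exists_posDef_invariantForm P
  rintro S ⟨k, hk⟩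
  have hne : ∑ i ∈ S, unitRoot B (i : ι) ≠ 0 := by
    intro h0
    have hcoeff := coeff_sum_smul b S (fun i => (√(B.form (P.root i) (P.root i)))⁻¹)
      (fun i => P.root i) k
    simp only [unitRoot] at h0
    simp only [h0, coeff_zero, coeff_simpleRoot, mul_ite, mul_one, mul_zero, sum_ite_eq', hk,
      if_true] at hcoeff
    exact (inv_pos.mpr (Real.sqrt_pos.mpr (hB _ (P.ne_zero k)))).ne hcoeff
  obtain ⟨i, hi, hsub⟩ := exists_subsingleton_setOf_le_neg_half B.form
    (v := fun i : b.support => unitRoot B (i : ι)) (fun i => form_unitRoot_self hB i)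
    (fun _ _ => form_unitRoot_nonpos hB) (hB _ hne)
  exact ⟨i, hi, hsub.anti (Set.inter_subset_inter_left _ fun j => form_unitRoot_le_of_adj hB)⟩

lemma IsCoxeterElement.isConj {c c' : P.weylGroup} (hc : IsCoxeterElement b c)
    (hc' : IsCoxeterElement b c') : IsConj c c' := by
  obtain ⟨l, hl, hl', rfl⟩ := hc
  obtain ⟨m, hm, hm', rfl⟩ := hc'
  have hlm : l.Perm m := (List.perm_ext_iff_of_nodup hl hm).mpr fun a => by simp only [hl', hm']
  rw [wordProd_eq_prod_map, wordProd_eq_prod_map]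
  exact ((isOneDegenerate_coxeterGraph b).wordEquiv_of_perm hl hlm).isConj_prod
    fun _ _ => commute_ofIdx_of_not_adj b

end CoxeterElement

section ColourReflection

variable [P.IsRootSystem] (b : P.Base)

/-- The part of the pairing `⟨αᵢ^∨, x⟩` which comes from the simple roots other than `αᵢ`. -/
def offDiagPairing (x : M) (i : b.support) : ℝ := P.coroot' i x - 2 * coeff b x i

open Classical in
lemma offDiagPairing_eq_sum_erase (x : M) (i : b.support) :
    offDiagPairing b x i = ∑ j ∈ univ.erase i, cartan b i j * coeff b x j := by
  rw [offDiagPairing, coroot'_eq_sum_cartan_mul_coeff, ← add_sum_erase _ _ (mem_univ i),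
    cartan_self, add_sub_cancel_left]

open Classical in
lemma offDiagPairing_simpleRoot (i j : b.support) :
    offDiagPairing b (P.root j) i = if j = i then 0 else cartan b i j := by
  rw [offDiagPairing, coeff_simpleRoot, P.root_coroot'_eq_pairing, ← cartan]
  split_ifs with hji
  · rw [hji, cartan_self, mul_one, sub_self]
  · rw [mul_zero, sub_zero]

variable [Finite ι] [P.IsCrystallographic] (ε : (coxeterGraph b).Coloring ℤˣ)

lemma offDiagPairing_congr {x y : M} {i : b.support}
    (h : ∀ j, ε j ≠ ε i → coeff b x j = coeff b y j) :
    offDiagPairing b x i = offDiagPairing b y i := by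
  classical
  simp only [offDiagPairing_eq_sum_erase]
  refine sum_congr rfl fun j hj => ?_
  by_cases hji : ε j = ε i
  · rw [cartan_eq_zero b ε (Finset.ne_of_mem_erase hj).symm hji.symm, zero_mul, zero_mul]
  · rw [h j hji]

/-- The product of all simple reflections of colour `s`; they commute, so their order does not
matter. -/
def colourRefl (s : ℤˣ) : P.weylGroup := wordProd b (univ.filter (ε · = s)).toList

open Classical in
lemma coeff_wordProd_smul_of_colour {s : ℤˣ} {l : List b.support} (hl : l.Nodup)
    (hs : ∀ i ∈ l, ε i = s) (x : M) (i : b.support) :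
    coeff b (wordProd b l • x) i =
      if i ∈ l then -coeff b x i - offDiagPairing b x i else coeff b x i := by
  induction l generalizing i with
  | nil => simp [wordProd_eq_prod_map]
  | cons a l ih =>
    obtain ⟨ha, hl⟩ := List.nodup_cons.mp hl
    obtain ⟨has, hs⟩ := List.forall_mem_cons.mp hs
    have ih := ih hl hs
    have hpair : P.coroot' a (wordProd b l • x) = 2 * coeff b x a + offDiagPairing b x a := by
      rw [← offDiagPairing_congr b ε fun j hj => (ih j).trans (if_neg fun hjl => hj ?_),
        offDiagPairing, ih, if_neg ha, add_sub_cancel]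
      rw [hs j hjl, has]
    have hrefl : coeff b (wordProd b (a :: l) • x) i = coeff b (wordProd b l • x) i -
        (∑ k, cartan b a k * coeff b (wordProd b l • x) k) * coeff b (P.root a) i := by
      rw [wordProd_cons, mul_smul]
      exact coeff_reflection b a i _
    rw [hrefl, ← coroot'_eq_sum_cartan_mul_coeff, hpair, ih, coeff_simpleRoot]
    by_cases hia : a = i
    · subst hia
      rw [if_neg ha, if_pos rfl, if_pos List.mem_cons_self]
      ring
    · simp [hia, Ne.symm hia]

lemma coeff_colourRefl_smul (s : ℤˣ) (x : M) (i : b.support) :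
    coeff b (colourRefl b ε s • x) i =
      if ε i = s then -coeff b x i - offDiagPairing b x i else coeff b x i := by
  rw [colourRefl, coeff_wordProd_smul_of_colour b ε (s := s) (nodup_toList _)
    (fun i hi => by simpa using hi)]
  simp

lemma offDiagPairing_colourRefl_smul (x : M) (i : b.support) :
    offDiagPairing b (colourRefl b ε (ε i) • x) i = offDiagPairing b x i :=
  offDiagPairing_congr b ε fun j hj => by rw [coeff_colourRefl_smul, if_neg hj]

lemma colourRefl_mul_self (s : ℤˣ) : colourRefl b ε s * colourRefl b ε s = 1 := by
  refine weylGroup_ext fun x => coeff_ext b fun i => ?_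
  rw [mul_smul, one_smul]
  by_cases hi : ε i = s
  · subst hi
    rw [coeff_colourRefl_smul, if_pos rfl, offDiagPairing_colourRefl_smul, coeff_colourRefl_smul,
      if_pos rfl]
    ring
  · rw [coeff_colourRefl_smul, if_neg hi, coeff_colourRefl_smul, if_neg hi]

lemma colourRefl_smul_simpleRoot {s : ℤˣ} {i : b.support} (hi : ε i = s) :
    colourRefl b ε s • P.root i = -P.root i := by
  classical
  refine coeff_ext b fun j => ?_
  rw [coeff_colourRefl_smul, coeff_neg, coeff_simpleRoot, offDiagPairing_simpleRoot]
  by_cases hij : i = j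
  · simp [← hij, hi]
  · simp only [hij, if_false, neg_zero, zero_sub, ite_eq_right_iff, neg_eq_zero]
    exact fun hj => cartan_eq_zero b ε (Ne.symm hij) (hj.trans hi.symm)

end ColourReflection

section EulerForm

variable [P.IsRootSystem] (b : P.Base)

/-- The Euler form of the orientation of the Coxeter graph whose sources are the vertices of
colour `s`, for a symmetrizer `d` of the Cartan matrix. -/
def eulerForm (ε : b.support → ℤˣ) (d : b.support → ℝ) (s : ℤˣ) (x y : M) : ℝ :=
  ∑ i, d i * coeff b x i * (coeff b y i + if ε i = s then offDiagPairing b y i else 0)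

lemma eulerForm_neg_left (ε : b.support → ℤˣ) (d : b.support → ℝ) (s : ℤˣ) (x y : M) :
    eulerForm b ε d s (-x) y = -eulerForm b ε d s x y := by
  simp only [eulerForm, coeff_neg, mul_neg, neg_mul, sum_neg_distrib]

lemma eulerForm_simpleRoot_left (ε : b.support → ℤˣ) (d : b.support → ℝ) (s : ℤˣ)
    (i : b.support) (y : M) : eulerForm b ε d s (P.root i) y =
      d i * (coeff b y i + if ε i = s then offDiagPairing b y i else 0) := by
  classical
  simp [eulerForm, coeff_simpleRoot]

variable {b} {d : b.support → ℝ} (hd : IsSymmetrizer b d)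
include hd

variable [Finite ι] [P.IsCrystallographic] (ε : (coxeterGraph b).Coloring ℤˣ)

lemma eulerForm_swap (s : ℤˣ) (x y : M) :
    eulerForm b ε d s x y = eulerForm b ε d (-s) y x := by
  classical
  have hsum (r : ℤˣ) (x y : M) : eulerForm b ε d r x y = ∑ i, d i * coeff b x i * coeff b y i +
      ∑ i, ∑ j, if ε i = r ∧ ε j = -r then d i * cartan b i j * (coeff b x i * coeff b y j)
        else 0 := by
    simp only [eulerForm, mul_add, sum_add_distrib]
    congr 1
    refine sum_congr rfl fun i _ => ?_
    split_ifs with hi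
    · rw [offDiagPairing_eq_sum_erase, mul_sum, ← add_sum_erase univ _ (mem_univ i)]
      simp only [hi, units_ne_neg_self, true_and, if_false, zero_add]
      refine sum_congr rfl fun j hj => ?_
      split_ifs with hjr
      · ring
      · rw [cartan_eq_zero b ε (Finset.ne_of_mem_erase hj).symm
          (hi.trans (neg_neg r ▸ Int.units_ne_iff_eq_neg.mp hjr).symm)]
        ring
    · simp [hi]
  rw [hsum, hsum, sum_comm (γ := b.support)]
  congr 1
  · exact sum_congr rfl fun i _ => by ring
  · refine sum_congr rfl fun i _ => sum_congr rfl fun j _ => ?_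
    simp only [neg_neg, hd.2 j i, and_comm, mul_comm (coeff b x j)]

lemma eulerForm_colourRefl_smul (s r : ℤˣ) (x y : M) :
    eulerForm b ε d s (colourRefl b ε r • x) (colourRefl b ε r • y) = eulerForm b ε d s y x := by
  have hself (s : ℤˣ) (x y : M) :
      eulerForm b ε d s (colourRefl b ε s • x) (colourRefl b ε s • y) = eulerForm b ε d s y x := by
    refine sum_congr rfl fun i _ => ?_
    by_cases hi : ε i = s
    · subst hi
      rw [if_pos rfl, if_pos rfl, offDiagPairing_colourRefl_smul, coeff_colourRefl_smul,
        coeff_colourRefl_smul, if_pos rfl, if_pos rfl]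
      ring
    · rw [if_neg hi, if_neg hi, coeff_colourRefl_smul, coeff_colourRefl_smul, if_neg hi, if_neg hi]
      ring
  by_cases hrs : r = s
  · rw [hrs, hself]
  · rw [Int.units_ne_iff_eq_neg.mp hrs, eulerForm_swap hd, hself, eulerForm_swap hd, neg_neg]

lemma eulerForm_altProd_smul (s r : ℤˣ) (k : ℕ) (x y : M) :
    eulerForm b ε d (s * (-1) ^ k) (altProd (colourRefl b ε) r k • x)
        (altProd (colourRefl b ε) r k • y) =
      eulerForm b ε d s x y := by
  induction k with
  | zero => rw [altProd_zero, one_smul, one_smul, pow_zero, mul_one]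
  | succ k ih =>
    rw [altProd_succ, mul_smul, mul_smul, eulerForm_colourRefl_smul hd, eulerForm_swap hd, ← ih,
      pow_succ, mul_neg_one, mul_neg, neg_neg]

end EulerForm

section Averaging

lemma smul_sum_range_pow_smul {H X : Type*} [Monoid H] [AddCommGroup X] [DistribMulAction H X]
    {g : H} {x : X} {n : ℕ} (h : g ^ n • x = x) :
    g • ∑ m ∈ range n, g ^ m • x = ∑ m ∈ range n, g ^ m • x := by
  simp only [smul_sum, smul_smul, ← pow_succ']
  have hshift := sum_range_succ' (g ^ · • x) n
  rwa [sum_range_succ, h, pow_zero, one_smul, add_left_inj, eq_comm] at hshift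

end Averaging

section Walk

lemma tau_neg_simpleRoot [P.IsRootSystem] (b : P.Base) (ε : b.support → ℤˣ) (s : ℤˣ)
    (i : b.support) :
    tau b ε s (-P.root i) = if ε i = s then P.root i else -P.root i := by
  classical
  have hmax (j : b.support) : max (coeff b (-P.root i) j) 0 = 0 :=
    max_eq_right (by rw [coeff_negSimple]; split_ifs <;> norm_num)
  refine coeff_ext b fun j => ?_
  rw [tau_eq, coeff_tauOn]
  simp only [mem_filter, mem_univ, true_and, hmax, mul_zero, sum_const_zero, sub_zero]
  by_cases hij : i = j
  · rw [hij]
    split_ifs <;> simp only [coeff_neg, neg_neg]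
  · split_ifs <;> simp only [coeff_neg, coeff_simpleRoot, hij, if_false, neg_zero]

variable [Finite ι] [P.IsCrystallographic] [P.IsRootSystem] {b : P.Base}
  (ε : (coxeterGraph b).Coloring ℤˣ)

lemma tau_eq_colourRefl_smul {x : M} (hx : ∀ i, 0 ≤ coeff b x i) (s : ℤˣ) :
    tau b ε s x = colourRefl b ε s • x := by
  classical
  refine coeff_ext b fun i => ?_
  rw [tau_eq, coeff_tauOn, coeff_colourRefl_smul, offDiagPairing_eq_sum_erase]
  simp only [mem_filter, mem_univ, true_and, max_eq_left (hx _)]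

lemma exists_eq_simpleRoot_of_not_isPosRoot [P.IsReduced] {s : ℤˣ} {x : M} (hx : IsPosRoot b x)
    (h : ¬ IsPosRoot b (colourRefl b ε s • x)) : ∃ i : b.support, ε i = s ∧ x = P.root i := by
  rw [← tau_eq_colourRefl_smul ε hx.coeff_nonneg] at h
  obtain ⟨i, hi, hxi⟩ := (tau_mem b ε s (Or.inl hx)).resolve_left h
  have hxi' : x = if ε ⟨i, hi⟩ = s then P.root i else -P.root i := by
    rw [← tau_tau b ε s x, hxi]
    exact tau_neg_simpleRoot b ε s ⟨i, hi⟩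
  split_ifs at hxi' with his
  · exact ⟨⟨i, hi⟩, his, hxi'⟩
  · exact absurd (hxi' ▸ hx) (isPosRoot_simpleRoot b ⟨i, hi⟩).not_neg

lemma eq_zero_of_colourRefl_mul_smul_eq {s : ℤˣ} {x : M}
    (h : (colourRefl b ε (-s) * colourRefl b ε s) • x = x) : x = 0 := by
  have hst : colourRefl b ε s • x = colourRefl b ε (-s) • x := by
    conv_rhs => rw [← h]
    rw [smul_smul, ← mul_assoc, colourRefl_mul_self, one_mul]
  refine eq_zero_of_forall_coroot'_eq_zero b fun i => ?_
  have hi := congrArg (coeff b · i) hst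
  simp only [coeff_colourRefl_smul, offDiagPairing] at hi
  rcases eq_or_ne (ε i) s with his | his
  · rw [if_pos his, if_neg (his ▸ units_ne_neg_self s)] at hi
    linarith
  · rw [if_neg his, if_pos (Int.units_ne_iff_eq_neg.mp his)] at hi
    linarith

lemma exists_not_isPosRoot_altProd_smul {x : M} (hx : IsPosRoot b x) (s : ℤˣ) :
    ∃ k, ¬ IsPosRoot b (altProd (colourRefl b ε) s k • x) := by
  by_contra! hpos
  set g := colourRefl b ε (-s) * colourRefl b ε s with hg
  set n := orderOf (P.weylGroupToPerm g) with hn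
  have hgx : g ^ n • x = x := by
    obtain ⟨k, -, rfl⟩ := hx
    rw [P.weylGroup_apply_root, map_pow, hn, pow_orderOf_eq_one, Equiv.Perm.one_apply]
  have hsum : ∑ m ∈ range n, g ^ m • x = 0 :=
    eq_zero_of_colourRefl_mul_smul_eq ε (smul_sum_range_pow_smul hgx)
  obtain ⟨i, hi⟩ := hx.exists_coeff_pos
  have hcoeff : 0 < coeff b (∑ m ∈ range n, (1 : ℝ) • g ^ m • x) i := by
    rw [coeff_sum_smul]
    refine sum_pos' (fun m _ => ?_) ⟨0, mem_range.mpr (orderOf_pos _), ?_⟩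
    · rw [one_mul, hg, ← altProd_two_mul]
      exact (hpos _).coeff_nonneg i
    · rwa [one_mul, pow_zero, one_smul]
  simp only [one_smul, hsum, coeff_zero] at hcoeff
  exact hcoeff.false

variable (b) in
/-- Applying the products of simple reflections of one colour alternately, starting with the colour
`s`, takes the positive root `x` out of the positive roots at step `n` for the first time, namely
to the negative simple root with index `j`. -/
structure Exits (s : ℤˣ) (x : M) (n : ℕ) (j : b.support) : Prop where
  isPosRoot : ∀ m < n, IsPosRoot b (altProd (colourRefl b ε) s m • x)
  smul_eq : altProd (colourRefl b ε) s n • x = -P.root j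
  colour : ε j = -s * (-1) ^ n

lemma exists_exits [P.IsReduced] {x : M} (hx : IsPosRoot b x) (s : ℤˣ) :
    ∃ n j, Exits b ε s x n j := by
  classical
  have hex := exists_not_isPosRoot_altProd_smul ε hx s
  have hpos (m : ℕ) (hm : m < Nat.find hex) : IsPosRoot b (altProd (colourRefl b ε) s m • x) :=
    not_not.mp (Nat.find_min hex hm)
  have hn := Nat.find_spec hex
  rcases h : Nat.find hex with _ | n
  · rw [h, altProd_zero, one_smul] at hn
    exact absurd hx hn
  · rw [h] at hn hpos
    rw [altProd_succ, mul_smul] at hn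
    obtain ⟨j, hj, hxj⟩ := exists_eq_simpleRoot_of_not_isPosRoot ε (hpos n n.lt_succ_self) hn
    refine ⟨n + 1, j, hpos, ?_, ?_⟩
    · rw [altProd_succ, mul_smul, hxj, colourRefl_smul_simpleRoot b ε hj]
    · rw [hj, pow_succ, mul_neg_one, neg_mul_neg]

section Symmetrizer

variable {ε} {d : b.support → ℝ} {i i' : b.support} {n : ℕ}

lemma Exits.eulerForm_altProd_smul (h : Exits b ε (-ε i) (P.root i) n i')
    (hd : IsSymmetrizer b d) (s : ℤˣ) (y : M) :
    eulerForm b ε d (s * (-1) ^ n) (P.root i') (altProd (colourRefl b ε) (ε i) (n + 1) • y) =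
      eulerForm b ε d (-s) (P.root i) y := by
  calc
    _ = -eulerForm b ε d (s * (-1) ^ n) (altProd (colourRefl b ε) (-ε i) n • P.root i)
          (altProd (colourRefl b ε) (-ε i) n • colourRefl b ε (ε i) • y) := by
        rw [h.smul_eq, eulerForm_neg_left, neg_neg, altProd_succ', mul_smul]
    _ = eulerForm b ε d s (colourRefl b ε (ε i) • P.root i) (colourRefl b ε (ε i) • y) := by
        rw [FZ.eulerForm_altProd_smul hd, colourRefl_smul_simpleRoot b ε rfl, eulerForm_neg_left]
    _ = eulerForm b ε d (-s) (P.root i) y := by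
        rw [eulerForm_colourRefl_smul hd, eulerForm_swap hd]

lemma Exits.mul_coeff_altProd_smul (h : Exits b ε (-ε i) (P.root i) n i')
    (hd : IsSymmetrizer b d) (y : M) :
    d i' * coeff b (altProd (colourRefl b ε) (ε i) (n + 1) • y) i' =
      d i * (coeff b y i + offDiagPairing b y i) := by
  have hy := h.eulerForm_altProd_smul hd (-ε i) y
  rwa [eulerForm_simpleRoot_left, eulerForm_simpleRoot_left, h.colour, neg_neg, if_pos rfl,
    if_neg (by rw [neg_mul]; exact units_ne_neg_self _), add_zero] at hy

lemma Exits.mul_coeff_add_offDiagPairing_altProd_smul (h : Exits b ε (-ε i) (P.root i) n i')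
    (hd : IsSymmetrizer b d) (y : M) :
    d i' * (coeff b (altProd (colourRefl b ε) (ε i) (n + 1) • y) i' +
      offDiagPairing b (altProd (colourRefl b ε) (ε i) (n + 1) • y) i') = d i * coeff b y i := by
  have hy := h.eulerForm_altProd_smul hd (ε i) y
  rwa [eulerForm_simpleRoot_left, eulerForm_simpleRoot_left, h.colour, neg_neg, if_pos rfl,
    if_neg (units_ne_neg_self _), add_zero] at hy

end Symmetrizer

variable {ε}

lemma Exits.le_of_adj {i j i' j' : b.support} {n m : ℕ}
    (hi : Exits b ε (-ε i) (P.root i) n i') (hj : Exits b ε (-ε j) (P.root j) m j')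
    (hij : (coxeterGraph b).Adj i j) : m ≤ n := by
  classical
  by_contra! hnm
  obtain ⟨d, hd⟩ := exists_isSymmetrizer b
  have hneg := hi.mul_coeff_altProd_smul hd (P.root j)
  have hzero := hi.mul_coeff_add_offDiagPairing_altProd_smul hd (P.root j)
  rw [coeff_simpleRoot, if_neg hij.1.symm, offDiagPairing_simpleRoot, if_neg hij.1.symm,
    zero_add] at hneg
  rw [coeff_simpleRoot, if_neg hij.1.symm, mul_zero,
    mul_eq_zero_iff_left (hd.1 i').ne'] at hzero
  have hneg' : coeff b (altProd (colourRefl b ε) (ε i) (n + 1) • P.root j) i' < 0 :=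
    (pos_iff_neg_of_mul_neg (hneg ▸ mul_neg_of_pos_of_neg (hd.1 i) (cartan_neg_of_adj b hij))).mp
      (hd.1 i')
  rw [← Int.units_ne_iff_eq_neg.mp (ε.valid hij)] at hj
  rcases Nat.lt_or_eq_of_le hnm with hlt | rfl
  · exact ((hj.isPosRoot _ hlt).coeff_nonneg i').not_gt hneg'
  · rw [hj.smul_eq] at hneg' hzero
    obtain rfl : j' = i' := by
      by_contra hne
      simp [coeff_neg, coeff_simpleRoot, hne] at hneg'
    rw [offDiagPairing, map_neg, P.root_coroot'_eq_pairing, P.pairing_same, coeff_neg,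
      coeff_simpleRoot, if_pos rfl] at hzero
    norm_num at hzero

end Walk

section CoxeterNumber

lemma nonempty_support [P.IsRootSystem] [P.IsIrreducible] (b : P.Base) : Nonempty b.support := by
  have : Nontrivial M := RootPairing.IsIrreducible.nontrivial P
  have : Nonempty ι := by
    by_contra! hι
    have htop : P.rootSpan ℝ = ⊤ := by simp
    rw [RootPairing.rootSpan, Set.range_eq_empty, Submodule.span_empty] at htop
    exact bot_ne_top htop
  exact b.support_nonempty.to_subtype

variable [Finite ι] [P.IsCrystallographic] {b : P.Base}

lemma eq_or_adj_of_cartanMatrix_ne_zero {i j : b.support}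
    (h : b.cartanMatrix j i ≠ 0) :
    i = j ∨ (coxeterGraph b).Adj i j := by
  refine or_iff_not_imp_left.mpr fun hij => by_contra fun hadj => h ?_
  exact b.cartanMatrix_apply_eq_zero_iff_pairing.mpr (isOrthogonal_of_not_adj b hij hadj).2

lemma forall_eq_of_forall_adj_eq [P.IsReduced] [P.IsIrreducible] {α : Type*} {n : b.support → α}
    (hn : ∀ i j, (coxeterGraph b).Adj i j → n i = n j) (i j : b.support) : n i = n j := by
  refine b.induction_on_cartanMatrix (fun k => n i = n k) rfl fun k l hk hkl => hk.trans ?_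
  rcases eq_or_adj_of_cartanMatrix_ne_zero hkl with rfl | hadj
  · rfl
  · exact hn k l hadj

lemma exists_adj [P.IsReduced] [P.IsIrreducible] (hcard : 2 ≤ b.support.card) :
    ∃ i j, (coxeterGraph b).Adj i j := by
  by_contra! hadj
  obtain ⟨i, hi, j, hj, hij⟩ := Finset.one_lt_card.mp hcard
  exact hij (congrArg Subtype.val (forall_eq_of_forall_adj_eq (n := id)
    (fun k l hkl => absurd hkl (hadj k l)) ⟨i, hi⟩ ⟨j, hj⟩))

variable [P.IsRootSystem] (ε : (coxeterGraph b).Coloring ℤˣ)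

/-- Starting from any simple root, alternating reflections lead out of the positive roots after the
same number `h` of steps; `f` records at which negative simple root. It turns out that `h` is the
Coxeter number and that `f` describes the action of `-w₀` on the simple roots. -/
def UniformExit (h : ℕ) (f : b.support → b.support) : Prop :=
  ∀ i, Exits b ε (-ε i) (P.root i) h (f i)

lemma exists_uniformExit [P.IsReduced] [P.IsIrreducible] : ∃ h f, UniformExit ε h f := by
  choose n f hnf using fun i : b.support => exists_exits ε (isPosRoot_simpleRoot b i) (-ε i)
  have hn := forall_eq_of_forall_adj_eq (n := n) fun i j hij =>
    le_antisymm ((hnf j).le_of_adj (hnf i) hij.symm) ((hnf i).le_of_adj (hnf j) hij)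
  rcases isEmpty_or_nonempty b.support with _ | ⟨⟨i⟩⟩
  · exact ⟨0, f, isEmptyElim⟩
  · exact ⟨n i, f, fun j => hn i j ▸ hnf j⟩

namespace UniformExit

variable {ε} {h : ℕ} {f : b.support → b.support} (hf : UniformExit ε h f)
include hf

omit [Finite ι] [P.IsCrystallographic] [P.IsRootSystem] in
lemma colour (i : b.support) : ε (f i) = ε i * (-1) ^ h := by
  rw [(hf i).colour, neg_neg]

omit [Finite ι] [P.IsCrystallographic] [P.IsRootSystem] in
lemma even_of_forall_eq [Nonempty b.support] (hid : ∀ i, f i = i) : Even h := by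
  obtain ⟨i⟩ := ‹Nonempty b.support›
  by_contra hodd
  have hi := hf.colour i
  rw [hid, (Nat.not_even_iff_odd.mp hodd).neg_one_pow, mul_neg_one] at hi
  exact units_ne_neg_self _ hi

omit [Finite ι] [P.IsCrystallographic] in
lemma ne_zero (i : b.support) : h ≠ 0 := by
  rintro rfl
  have hi := (hf i).smul_eq
  rw [altProd_zero, one_smul] at hi
  exact (isPosRoot_simpleRoot b (f i)).not_neg (hi ▸ isPosRoot_simpleRoot b i)

lemma altProd_smul_root (s : ℤˣ) (i : b.support) :
    altProd (colourRefl b ε) s h • P.root i = -P.root (f i) := by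
  rcases eq_or_ne s (ε i) with rfl | hs
  · obtain ⟨k, rfl⟩ := Nat.exists_eq_succ_of_ne_zero (hf.ne_zero i)
    have hlast : colourRefl b ε (-ε i * (-1) ^ k) • P.root (f i) = -P.root (f i) :=
      colourRefl_smul_simpleRoot b ε (by rw [hf.colour, pow_succ, mul_neg_one, mul_neg, neg_mul])
    have hexit := (hf i).smul_eq
    rw [Nat.succ_eq_add_one, altProd_succ, mul_smul, ← hlast] at hexit
    rw [Nat.succ_eq_add_one, altProd_succ', mul_smul, colourRefl_smul_simpleRoot b ε rfl,
      smul_neg, smul_left_cancel _ hexit]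
  · rw [Int.units_ne_iff_eq_neg.mp hs, (hf i).smul_eq]

omit [Finite ι] [P.IsCrystallographic] in
lemma lt_two_mul {i : b.support} {m : ℕ} (hm : m ≠ 0)
    (h1 : altProd (colourRefl b ε) (-ε i) (2 * m) = 1) : h < 2 * m := by
  by_contra! hle
  have hpos := (hf i).isPosRoot (h - 2 * m) (by lia)
  have hsplit := altProd_add (colourRefl b ε) (-ε i) (h - 2 * m) (2 * m)
  rw [Nat.sub_add_cancel hle, h1, mul_one, (even_two_mul m).neg_one_pow, mul_one] at hsplit
  rw [← hsplit, (hf i).smul_eq] at hpos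
  exact (isPosRoot_simpleRoot b (f i)).not_neg hpos

variable [P.IsReduced]

lemma altProd_mul_altProd (s r : ℤˣ) :
    altProd (colourRefl b ε) s h * altProd (colourRefl b ε) r h = 1 := by
  refine eq_one_of_isPosRoot (b := b) fun i => ?_
  rw [mul_smul, hf.altProd_smul_root, smul_neg, hf.altProd_smul_root, neg_neg]
  exact isPosRoot_simpleRoot b _

lemma involutive : Function.Involutive f := fun i => by
  have hi := congrArg (· • P.root i) (hf.altProd_mul_altProd 1 1)
  simp only [mul_smul, one_smul, hf.altProd_smul_root, smul_neg, neg_neg] at hi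
  exact Subtype.ext (P.root.injective hi)

section Longest

variable {w₀ : P.weylGroup} (hw₀ : IsLongest b w₀)
include hw₀

lemma altProd_eq_longest (s : ℤˣ) : altProd (colourRefl b ε) s h = w₀ := by
  refine eq_of_forall_not_isPosRoot (b := b) (fun i => ?_) hw₀.not_isPosRoot
  rw [hf.altProd_smul_root]
  exact (isPosRoot_simpleRoot b (f i)).not_neg

lemma longest_smul_root (i : b.support) : w₀ • P.root i = -P.root (f i) := by
  rw [← hf.altProd_eq_longest hw₀ 1, hf.altProd_smul_root]

lemma longest_mul_self : w₀ * w₀ = 1 := by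
  rw [← hf.altProd_mul_altProd 1 1, hf.altProd_eq_longest hw₀]

lemma isNegOne_iff : IsNegOne w₀ ↔ ∀ i, f i = i := by
  refine ⟨fun hneg i => ?_, fun hid x => ?_⟩
  · have hi := hf.longest_smul_root hw₀ i
    rw [hneg, neg_inj] at hi
    exact (Subtype.ext (P.root.injective hi)).symm
  · rw [← sum_coeff_smul_root b x, smul_sum, ← sum_neg_distrib]
    refine sum_congr rfl fun i _ => ?_
    rw [smul_comm, hf.longest_smul_root hw₀, hid, smul_neg]

end Longest

lemma orderOf_colourRefl_mul_colourRefl [Nonempty b.support] :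
    orderOf (colourRefl b ε (-1) * colourRefl b ε 1) = h := by
  obtain ⟨i⟩ := ‹Nonempty b.support›
  set n := orderOf (colourRefl b ε (-1) * colourRefl b ε 1)
  have hdvd : n ∣ h := (altProd_two_mul_eq_one_iff _ (-ε i) h).mp
    (by rw [two_mul, altProd_add, hf.altProd_mul_altProd])
  have hlt : h < 2 * n := hf.lt_two_mul (ne_zero_of_dvd_ne_zero (hf.ne_zero i) hdvd)
    ((altProd_two_mul_eq_one_iff _ (-ε i) n).mpr dvd_rfl)
  exact (Nat.eq_of_dvd_of_lt_two_mul (hf.ne_zero i) hdvd hlt).symm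

end UniformExit

omit [Finite ι] [P.IsCrystallographic] [P.IsRootSystem] in
lemma isCoxeterElement_colourRefl_mul_colourRefl :
    IsCoxeterElement b (colourRefl b ε (-1) * colourRefl b ε 1) := by
  refine ⟨_, ?_, fun i => ?_, (wordProd_append b _ _).symm⟩
  · refine List.Nodup.append (nodup_toList _) (nodup_toList _) fun i hi hi' => ?_
    simp only [mem_toList, mem_filter, mem_univ, true_and] at hi hi'
    rw [hi] at hi'
    contradiction
  · simp only [List.mem_append, mem_toList, mem_filter, mem_univ, true_and]
    exact (Int.units_eq_one_or (ε i)).symm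

lemma UniformExit.orderOf_coxeterElement {ε : (coxeterGraph b).Coloring ℤˣ} {h : ℕ}
    {f : b.support → b.support} (hf : UniformExit ε h f) [P.IsReduced] [Nonempty b.support]
    {c : P.weylGroup} (hc : IsCoxeterElement b c) : orderOf c = h := by
  obtain ⟨w, hw⟩ := isConj_iff.mp (hc.isConj (isCoxeterElement_colourRefl_mul_colourRefl ε))
  rw [← hf.orderOf_colourRefl_mul_colourRefl, ← hw]
  exact SemiconjBy.orderOf_eq w (by simp [SemiconjBy])

end CoxeterNumber

section AlmostPositive

/-- The negative simple root with index `i`, as an element of `Φ_{≥ -1}`. -/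
def negRoot (b : P.Base) (i : b.support) : almostPos b := ⟨-P.root i, Or.inr ⟨i, i.2, rfl⟩⟩

lemma negRoot_injective (b : P.Base) : Function.Injective (negRoot b) := fun _ _ h =>
  Subtype.ext (P.root.injective (neg_injective (congrArg Subtype.val h)))

lemma exists_eq_negRoot {b : P.Base} {x : almostPos b} (hx : (x : M) ∈ negSimple b) :
    ∃ i, x = negRoot b i :=
  let ⟨i, hi, hxi⟩ := hx
  ⟨⟨i, hi⟩, Subtype.ext hxi⟩

variable [Finite ι] [P.IsCrystallographic] [P.IsRootSystem] [P.IsReduced] {b : P.Base}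
  {ε : (coxeterGraph b).Coloring ℤˣ}

omit [Finite ι] [P.IsCrystallographic] [P.IsReduced] in
lemma IsPosRoot.notMem_negSimple {x : M} (hx : IsPosRoot b x) :
    x ∉ negSimple b := by
  rintro ⟨i, hi, rfl⟩
  exact (isPosRoot_simpleRoot b ⟨i, hi⟩).not_neg hx

variable (ε) in
lemma tauPerm_mul_self (s : ℤˣ) : tauPerm b ε s * tauPerm b ε s = 1 :=
  Equiv.ext fun x => Subtype.ext (tau_tau b ε s x)

lemma tauPerm_negRoot_of_ne {s : ℤˣ} {i : b.support} (h : ε i ≠ s) :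
    tauPerm b ε s (negRoot b i) = negRoot b i :=
  Subtype.ext ((tau_neg_simpleRoot b ε s i).trans (if_neg h))

lemma coe_tauPerm_negRoot (i : b.support) : (tauPerm b ε (ε i) (negRoot b i) : M) = P.root i :=
  (tau_neg_simpleRoot b ε _ i).trans (if_pos rfl)

variable (ε) in
lemma D_eq_closure (s : ℤˣ) : D b ε = Subgroup.closure {tauPerm b ε (-s), tauPerm b ε s} := by
  rcases Int.units_eq_one_or s with rfl | rfl
  · rfl
  · rw [neg_neg, Set.pair_comm, D]

lemma altProd_tauPerm_mem_D (s : ℤˣ) (k : ℕ) : altProd (tauPerm b ε) s k ∈ D b ε := by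
  induction k with
  | zero => exact one_mem _
  | succ k ih =>
    refine mul_mem (Subgroup.subset_closure ?_) ih
    rcases Int.units_eq_one_or (s * (-1) ^ k) with hs | hs <;> simp [hs]

lemma Exits.coe_altProd_tauPerm {s : ℤˣ} {x : almostPos b} {n : ℕ} {j : b.support}
    (h : Exits b ε s x n j) {m : ℕ} (hm : m ≤ n) :
    (altProd (tauPerm b ε) s m x : M) = altProd (colourRefl b ε) s m • (x : M) := by
  induction m with
  | zero => rw [altProd_zero, altProd_zero, one_smul, Equiv.Perm.one_apply]
  | succ m ih =>
    have hm' := ih (by lia)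
    rw [altProd_succ, altProd_succ, mul_smul, ← hm', ← tau_eq_colourRefl_smul ε]
    · rfl
    · rw [hm']
      exact (h.isPosRoot m hm).coeff_nonneg

lemma orbit_D_subset {S : Set (almostPos b)} (hS : ∀ s, ∀ x ∈ S, tauPerm b ε s x ∈ S)
    {x : almostPos b} (hx : x ∈ S) : MulAction.orbit (D b ε) x ⊆ S :=
  orbit_closure_subset (by rintro a (rfl | rfl) <;> exact tauPerm_mul_self ε _)
    (by rintro a (rfl | rfl) y hy <;> exact hS _ y hy) hx

variable (ε) in
lemma exists_negRoot_mem_orbit (x : almostPos b) :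
    ∃ i, negRoot b i ∈ MulAction.orbit (D b ε) x := by
  rcases x.2 with hx | hx
  · obtain ⟨n, j, hnj⟩ := exists_exits ε hx 1
    exact ⟨j, ⟨_, altProd_tauPerm_mem_D 1 n⟩,
      Subtype.ext ((hnj.coe_altProd_tauPerm le_rfl).trans hnj.smul_eq)⟩
  · obtain ⟨i, rfl⟩ := exists_eq_negRoot hx
    exact ⟨i, MulAction.mem_orbit_self _⟩

lemma altProd_tauPerm_two_mul_eq_one {s : ℤˣ} {m : ℕ}
    (h : ∀ i, altProd (tauPerm b ε) s (2 * m) (negRoot b i) = negRoot b i) :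
    altProd (tauPerm b ε) s (2 * m) = 1 := by
  refine Equiv.ext fun x => ?_
  obtain ⟨i, hi⟩ := exists_negRoot_mem_orbit ε x
  rw [MulAction.mem_orbit_symm, D_eq_closure ε s] at hi
  rw [altProd_two_mul] at h ⊢
  exact pow_smul_eq_of_mem_orbit_closure (tauPerm_mul_self ε _) (tauPerm_mul_self ε _) (h i) hi

namespace UniformExit

variable {h : ℕ} {f : b.support → b.support} (hf : UniformExit ε h f)
include hf

lemma coe_altProd_tauPerm_negRoot (i : b.support) {m : ℕ} (hm : m ≤ h) :
    (altProd (tauPerm b ε) (ε i) (m + 1) (negRoot b i) : M) =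
      altProd (colourRefl b ε) (-ε i) m • P.root i := by
  have hi := hf i
  rw [← coe_tauPerm_negRoot (ε := ε) i] at hi ⊢
  rw [altProd_succ', Equiv.Perm.mul_apply, hi.coe_altProd_tauPerm hm]

lemma isPosRoot_altProd_tauPerm (i : b.support) {m : ℕ} (hm : m < h) :
    IsPosRoot b (altProd (tauPerm b ε) (ε i) (m + 1) (negRoot b i) : M) := by
  rw [hf.coe_altProd_tauPerm_negRoot i hm.le]
  exact (hf i).isPosRoot m hm

lemma altProd_tauPerm_succ (i : b.support) :
    altProd (tauPerm b ε) (ε i) (h + 1) (negRoot b i) = negRoot b (f i) :=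
  Subtype.ext ((hf.coe_altProd_tauPerm_negRoot i le_rfl).trans (hf i).smul_eq)

lemma tauPerm_negRoot (i : b.support) :
    tauPerm b ε (ε i * (-1) ^ (h + 1)) (negRoot b (f i)) = negRoot b (f i) := by
  refine tauPerm_negRoot_of_ne ?_
  rw [hf.colour, pow_succ, mul_neg_one, mul_neg]
  exact units_ne_neg_self _

lemma altProd_tauPerm_add_two (s : ℤˣ) (i : b.support) :
    altProd (tauPerm b ε) s (h + 2) (negRoot b i) = negRoot b (f i) := by
  rcases eq_or_ne s (ε i) with rfl | hs
  · rw [altProd_succ, Equiv.Perm.mul_apply, hf.altProd_tauPerm_succ, hf.tauPerm_negRoot]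
  · rw [altProd_succ', Equiv.Perm.mul_apply, tauPerm_negRoot_of_ne hs.symm,
      Int.units_ne_iff_eq_neg.mp hs, neg_neg, hf.altProd_tauPerm_succ]

lemma orderOf_tauPerm_dvd : orderOf (tauPerm b ε (-1) * tauPerm b ε 1) ∣ h + 2 := by
  refine (altProd_two_mul_eq_one_iff _ 1 _).mp (altProd_tauPerm_two_mul_eq_one fun i => ?_)
  rw [two_mul, altProd_add, Equiv.Perm.mul_apply, hf.altProd_tauPerm_add_two,
    hf.altProd_tauPerm_add_two, hf.involutive]

lemma add_two_le_two_mul {i : b.support} {m : ℕ} (hm : m ≠ 0)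
    (h1 : altProd (tauPerm b ε) (-ε i) (2 * m) = 1) : h + 2 ≤ 2 * m := by
  by_contra! hlt
  obtain ⟨k, hk⟩ : ∃ k, 2 * m = k + 1 + 1 := ⟨2 * m - 2, by lia⟩
  have hpos := hf.isPosRoot_altProd_tauPerm i (m := k) (by lia)
  have hfix := congrArg (· (negRoot b i)) h1
  simp only [hk, altProd_succ' _ (-ε i), neg_neg, Equiv.Perm.mul_apply,
    tauPerm_negRoot_of_ne (units_ne_neg_self _), Equiv.Perm.one_apply] at hfix
  rw [hfix] at hpos
  exact (isPosRoot_simpleRoot b i).not_neg hpos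

lemma add_two_le_two_mul_orderOf_tauPerm [Nonempty b.support] :
    h + 2 ≤ 2 * orderOf (tauPerm b ε (-1) * tauPerm b ε 1) := by
  obtain ⟨i⟩ := ‹Nonempty b.support›
  exact hf.add_two_le_two_mul (ne_zero_of_dvd_ne_zero (by lia) hf.orderOf_tauPerm_dvd)
    ((altProd_two_mul_eq_one_iff _ (-ε i) _).mpr dvd_rfl)

lemma two_mul_orderOf_tauPerm [Nonempty b.support] (hid : ∀ i, f i = i) :
    2 * orderOf (tauPerm b ε (-1) * tauPerm b ε 1) = h + 2 := by
  obtain ⟨k, rfl⟩ := (even_iff_exists_two_mul).mp (hf.even_of_forall_eq hid)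
  have hdvd : orderOf (tauPerm b ε (-1) * tauPerm b ε 1) ∣ k + 1 := by
    refine (altProd_two_mul_eq_one_iff _ 1 _).mp (altProd_tauPerm_two_mul_eq_one fun i => ?_)
    rw [mul_add_one, hf.altProd_tauPerm_add_two, hid]
  have hle := hf.add_two_le_two_mul_orderOf_tauPerm
  have hle' := Nat.le_of_dvd k.succ_pos hdvd
  lia

lemma orderOf_tauPerm [Nonempty b.support] (hid : ¬ ∀ i, f i = i) :
    orderOf (tauPerm b ε (-1) * tauPerm b ε 1) = h + 2 := by
  refine (Nat.eq_of_dvd_of_lt_two_mul (by lia) hf.orderOf_tauPerm_dvd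
    (hf.add_two_le_two_mul_orderOf_tauPerm.lt_of_ne fun heq => hid fun i => ?_)).symm
  have hone := (altProd_two_mul_eq_one_iff (tauPerm b ε) 1 _).mpr dvd_rfl
  rw [← heq] at hone
  have hi := hf.altProd_tauPerm_add_two 1 i
  rw [hone, Equiv.Perm.one_apply] at hi
  exact (negRoot_injective b hi).symm

lemma orbit_subset (i : b.support) : MulAction.orbit (D b ε) (negRoot b i) ⊆
    {x | ∃ m ≤ h + 1, x = altProd (tauPerm b ε) (ε i) m (negRoot b i)} := by
  refine orbit_D_subset (fun s x hx => ?_) ⟨0, by lia, rfl⟩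
  obtain ⟨m, hm, rfl⟩ := hx
  rcases eq_or_ne s (ε i * (-1) ^ m) with rfl | hs
  · rcases hm.lt_or_eq with hlt | rfl
    · exact ⟨m + 1, hlt, by rw [altProd_succ, Equiv.Perm.mul_apply]⟩
    · exact ⟨h + 1, le_rfl, by rw [hf.altProd_tauPerm_succ, hf.tauPerm_negRoot]⟩
  · rcases m with _ | m
    · rw [pow_zero, mul_one] at hs
      exact ⟨0, hm, by rw [altProd_zero, Equiv.Perm.one_apply, tauPerm_negRoot_of_ne hs.symm]⟩
    · refine ⟨m, by lia, ?_⟩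
      rw [Int.units_ne_iff_eq_neg.mp hs, pow_succ, mul_neg_one, mul_neg, neg_neg, altProd_succ,
        ← Equiv.Perm.mul_apply, ← mul_assoc, tauPerm_mul_self, one_mul]

lemma orbit_inter_negSimple (i : b.support) :
    Subtype.val '' MulAction.orbit (D b ε) (negRoot b i) ∩ negSimple b =
      {-P.root i, -P.root (f i)} := by
  refine Set.Subset.antisymm ?_ ?_
  · rintro _ ⟨⟨x, hx, rfl⟩, hy⟩
    obtain ⟨_ | m, hm, rfl⟩ := hf.orbit_subset i hx
    · exact Or.inl rfl
    · rcases (Nat.le_of_succ_le_succ hm).lt_or_eq with hlt | rfl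
      · exact absurd hy (hf.isPosRoot_altProd_tauPerm i hlt).notMem_negSimple
      · rw [hf.altProd_tauPerm_succ]
        exact Or.inr rfl
  · rintro _ (rfl | rfl)
    · exact ⟨⟨negRoot b i, MulAction.mem_orbit_self _, rfl⟩, i, i.2, rfl⟩
    · exact ⟨⟨negRoot b (f i),
        ⟨⟨_, altProd_tauPerm_mem_D (ε i) (h + 1)⟩, hf.altProd_tauPerm_succ i⟩, rfl⟩,
        f i, (f i).2, rfl⟩

section Longest

variable {w₀ : P.weylGroup} (hw₀ : IsLongest b w₀)
include hw₀

lemma orbit_negGroup (i : b.support) :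
    MulAction.orbit (negGroup w₀) (-P.root i) = {-P.root i, -P.root (f i)} := by
  set g : M ≃ₗ[ℝ] M := LinearEquiv.neg ℝ * RootPairing.Equiv.weightHom P w₀
  have hg (x : M) : g x = -(w₀ • x) := rfl
  have hgroot (j : b.support) : g (-P.root j) = -P.root (f j) := by
    rw [hg, smul_neg, hf.longest_smul_root hw₀, neg_neg]
  have hgg : g * g = 1 := LinearEquiv.ext fun x => by
    rw [LinearEquiv.mul_apply, hg, hg, smul_neg, neg_neg, smul_smul, hf.longest_mul_self hw₀,
      one_smul]
    rfl
  refine Set.Subset.antisymm ?_ ?_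
  · rw [negGroup, Subgroup.zpowers_eq_closure]
    refine orbit_closure_subset (by rintro _ rfl; exact hgg) ?_ (Set.mem_insert _ _)
    rintro _ rfl _ (rfl | rfl)
    · exact Or.inr (hgroot i)
    · exact Or.inl ((hgroot (f i)).trans (by rw [hf.involutive]))
  · rintro _ (rfl | rfl)
    · exact MulAction.mem_orbit_self _
    · exact ⟨⟨g, Subgroup.mem_zpowers _⟩, hgroot i⟩

lemma bijOn_orbit_inter_negSimple :
    Set.BijOn (fun Ω : Set (almostPos b) => Subtype.val '' Ω ∩ negSimple b)
      {Ω | ∃ x, Ω = MulAction.orbit (D b ε) x}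
      {O : Set M | ∃ y ∈ negSimple b, O = MulAction.orbit (negGroup w₀) y} := by
  refine bijOn_image_orbit_inter Subtype.val_injective (fun y hy => ?_) (fun x => ?_)
    fun x hx => ?_
  · exact ⟨⟨y, Or.inr hy⟩, rfl⟩
  · obtain ⟨i, hi⟩ := exists_negRoot_mem_orbit ε x
    exact ⟨_, hi, i, i.2, rfl⟩
  · obtain ⟨i, rfl⟩ := exists_eq_negRoot hx
    exact (hf.orbit_inter_negSimple i).trans (hf.orbit_negGroup hw₀ i).symm

end Longest

end UniformExit

variable (ε) in
lemma tauPerm_mul_tauPerm_ne [P.IsIrreducible] (hcard : 2 ≤ b.support.card) :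
    tauPerm b ε (-1) * tauPerm b ε 1 ≠ tauPerm b ε 1 * tauPerm b ε (-1) := by
  classical
  intro hcomm
  obtain ⟨i, j, hij⟩ := exists_adj hcard
  have hcomm' : tauPerm b ε (-ε i) * tauPerm b ε (ε i) =
      tauPerm b ε (ε i) * tauPerm b ε (-ε i) := by
    rcases Int.units_eq_one_or (ε i) with hi | hi <;> rw [hi]
    · exact hcomm
    · rw [neg_neg, hcomm]
  have hfix : tauPerm b ε (-ε i) (tauPerm b ε (ε i) (negRoot b i)) =
      tauPerm b ε (ε i) (negRoot b i) := by
    rw [← Equiv.Perm.mul_apply, hcomm', Equiv.Perm.mul_apply,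
      tauPerm_negRoot_of_ne (units_ne_neg_self _)]
  have hroot : colourRefl b ε (-ε i) • P.root i = P.root i := by
    have hval := congrArg Subtype.val hfix
    rw [← tau_eq_colourRefl_smul ε (isPosRoot_simpleRoot b i).coeff_nonneg]
    rwa [← coe_tauPerm_negRoot (ε := ε) i]
  have hcoeff := coeff_colourRefl_smul b ε (-ε i) (P.root i) j
  rw [hroot, if_pos (Int.units_ne_iff_eq_neg.mp (ε.valid hij.symm)), coeff_simpleRoot,
    if_neg hij.1, offDiagPairing_simpleRoot, if_neg hij.1] at hcoeff
  linarith [cartan_neg_of_adj b hij.symm]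

end AlmostPositive

end FZ

end

theorem theorem2p6 {ι M N : Type*} [Finite ι] [AddCommGroup M] [Module ℝ M]
    [AddCommGroup N] [Module ℝ N] (P : RootPairing ι ℝ M N)
    [P.IsRootSystem] [P.IsCrystallographic] [P.IsReduced] [P.IsIrreducible]
    (b : P.Base) (ε : (FZ.coxeterGraph b).Coloring ℤˣ)
    (c : P.weylGroup) (hc : FZ.IsCoxeterElement b c)
    (w₀ : P.weylGroup) (hw₀ : FZ.IsLongest b w₀) :
    -- every `D`-orbit meets `-Π`
    (∀ x : FZ.almostPos b,
      (Subtype.val '' MulAction.orbit (FZ.D b ε) x ∩ FZ.negSimple b).Nonempty) ∧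
    -- `Ω ↦ Ω ∩ (-Π)` is a bijection from `D`-orbits in `Φ_{≥ -1}` to `⟨-w₀⟩`-orbits in `-Π`
    Set.BijOn (fun Ω : Set (FZ.almostPos b) => Subtype.val '' Ω ∩ FZ.negSimple b)
      {Ω | ∃ x, Ω = MulAction.orbit (FZ.D b ε) x}
      {O : Set M | ∃ y ∈ FZ.negSimple b, O = MulAction.orbit (FZ.negGroup w₀) y} ∧
    -- the order of `τ₋ τ₊`, with the Coxeter number `h = orderOf c`
    (FZ.IsNegOne w₀ →
      2 * orderOf (FZ.tauPerm b ε (-1) * FZ.tauPerm b ε 1) = orderOf c + 2) ∧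
    (¬ FZ.IsNegOne w₀ →
      orderOf (FZ.tauPerm b ε (-1) * FZ.tauPerm b ε 1) = orderOf c + 2) ∧
    -- for rank at least two, `D` is dihedral of order `h + 2` or `2 (h + 2)`
    (2 ≤ b.support.card →
      (FZ.IsNegOne w₀ → Nat.card (FZ.D b ε) = orderOf c + 2 ∧
        Nonempty (FZ.D b ε ≃* DihedralGroup ((orderOf c + 2) / 2))) ∧
      (¬ FZ.IsNegOne w₀ → Nat.card (FZ.D b ε) = 2 * (orderOf c + 2) ∧
        Nonempty (FZ.D b ε ≃* DihedralGroup (orderOf c + 2)))) := by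
  have := FZ.nonempty_support b
  obtain ⟨h, f, hf⟩ := FZ.exists_uniformExit ε
  rw [hf.orderOf_coxeterElement hc, hf.isNegOne_iff hw₀]
  have hmeet (x : FZ.almostPos b) :
      (Subtype.val '' MulAction.orbit (FZ.D b ε) x ∩ FZ.negSimple b).Nonempty :=
    let ⟨i, hi⟩ := FZ.exists_negRoot_mem_orbit ε x
    ⟨-P.root i, ⟨_, hi, rfl⟩, i, i.2, rfl⟩
  have hdihedral (hcard : 2 ≤ b.support.card) :=
    FZ.closure_pair_dihedral (FZ.tauPerm_mul_self ε (-1)) (FZ.tauPerm_mul_self ε 1)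
      (FZ.tauPerm_mul_tauPerm_ne ε hcard)
  refine ⟨hmeet, hf.bijOn_orbit_inter_negSimple hw₀, hf.two_mul_orderOf_tauPerm,
    hf.orderOf_tauPerm, fun hcard => ⟨fun hid => ?_, fun hid => ?_⟩⟩
  · rw [← hf.two_mul_orderOf_tauPerm hid, Nat.mul_div_cancel_left _ two_pos]
    exact hdihedral hcard
  · rw [← hf.orderOf_tauPerm hid]
    exact hdihedral hcard
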